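/- Notation. For $\mu\in\mathbb R$ put $e_\mu(x)=e^{i\mu x}$, $x\in\mathbb R$. $H_\infty^{\pm}$ is the class of boundary functions on $\mathbb R$ of bounded analytic functions in the half-plane $\pm\operatorname{Im}z>0$. $AP$ is the uniform closure of the linear span of $\{e_\mu:\mu\in\mathbb R\}$; for $f\in AP$, $\Omega(f)=\{\mu\in\mathbb R:\ \lim_{T\to\infty}\frac1{2T}\int_{-T}^{T}e^{-i\mu t}f(t)\,dt\neq0\}$ is the Bohr–Fourier spectrum of $f$, and $AP^{\pm}=\{f\in AP:\ \pm\Omega(f)\subset[0,\infty)\}$. Fix $\lambda>0$. A *representation* of a function $g$ on $\mathbb R$ consists of $\nu,\beta\in[0,\lambda]$ with $\nu+\beta>0$ and $a_\pm\in H_\infty^\pm$ such that $$g=a_-e_{-\beta}+a_+e_{\nu}.\tag{1}$$ For an integer $N\ge1$, $S_{\lambda,N}$ is the class of those $g$ that admit a representation (1) with $$\frac{\lambda}{\nu+\beta}=N,\qquad\text{and, if }N>1,\qquad e_{\frac{\beta}{N-1}}a_-\in H_\infty^+,\quad e_{-\frac{\nu}{N-1}}a_+\in H_\infty^-,\tag{2}$$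 and for which $N$ is the smallest value of $\lceil\lambda/(\nu+\beta)\rceil$ among all representations (1) of $g$. **Theorem.** Let $g=g_-+g_+$ with $g_\pm\in AP^\pm$ and $0\notin\Omega(g_\pm)$, and put $$\eta_{1-}=-\sup\Omega(g_-),\quad \eta_{2-}=-\inf\Omega(g_-),\quad \eta_{1+}=\inf\Omega(g_+),\quad \eta_{2+}=\sup\Omega(g_+)$$ in $[-\infty,+\infty]$, with $\inf\emptyset=+\infty$, $\sup\emptyset=-\infty$. (i) $g\in S_{\lambda,1}$ if and only if $\eta_{1+}+\eta_{1-}\ge\lambda$. (ii) For an integer $N>1$, $g\in S_{\lambda,N}$ if and only if $$N=\left\lceil\frac{\lambda}{\eta_{1-}+\eta_{1+}}\right\rceil,\qquad \eta_{1-}\ge\frac{N-1}{N}\eta_{2-},\qquad \eta_{1+}\ge\frac{N-1}{N}\eta_{2+},\qquad \eta_{2+}+\eta_{2-}\le\frac{\lambda}{N-1}$$ (where $\lambda/\infty=0$ and $\lambda/0=\infty$, so that the first equality requires $0<\eta_{1-}+\eta_{1+}<\infty$). Under the conditions of (ii), $$M:=\max\left\{\frac{\lambda}{N}-\eta_{1-},\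 \frac{N-1}{N}\eta_{2+}\right\}\ \le\ m:=\min\left\{\eta_{1+},\ \frac{\lambda-(N-1)\eta_{2-}}{N}\right\},$$ and for every real $\nu$ with $M\le\nu\le m$ the choice $$a_+=g_+e_{-\nu},\qquad \beta=\frac{\lambda}{N}-\nu,\qquad a_-=g_-e_{\beta}$$ delivers a representation (1) of $g$; it satisfies (2), and $a_\pm\in AP^\pm$. -/

import Mathlib

noncomputable section

namespace APGap

open Filter Topology MeasureTheory

/-- The exponential `e_μ(x) = exp(i μ x)` on the real line. -/
def e (μ : ℝ) (x : ℝ) : ℂ := Complex.exp (Complex.I * μ * x)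

/-- `f` is (a.e. equal to) the boundary function of a bounded analytic function in the open
upper half-plane: the Hardy class `H_∞^+`. -/
def HinfPlus : Set (ℝ → ℂ) :=
  {f | ∃ F : ℂ → ℂ, DifferentiableOn ℂ F {z : ℂ | 0 < z.im} ∧
    (∃ C : ℝ, ∀ z : ℂ, 0 < z.im → ‖F z‖ ≤ C) ∧
    ∀ᵐ x : ℝ, Tendsto (fun y : ℝ => F ((x : ℂ) + (y : ℂ) * Complex.I)) (𝓝[>] 0) (𝓝 (f x))}

/-- The Hardy class `H_∞^-` of the open lower half-plane. -/
def HinfMinus : Set (ℝ → ℂ) :=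
  {f | ∃ F : ℂ → ℂ, DifferentiableOn ℂ F {z : ℂ | z.im < 0} ∧
    (∃ C : ℝ, ∀ z : ℂ, z.im < 0 → ‖F z‖ ≤ C) ∧
    ∀ᵐ x : ℝ, Tendsto (fun y : ℝ => F ((x : ℂ) + (y : ℂ) * Complex.I)) (𝓝[<] 0) (𝓝 (f x))}

/-- `AP`: uniform limits on the real line of finite linear combinations of the `e_μ`. -/
def AP : Set (ℝ → ℂ) :=
  {f | ∀ ε : ℝ, 0 < ε → ∃ p ∈ Submodule.span ℂ (Set.range e), ∀ x : ℝ, ‖f x - p x‖ ≤ ε}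

/-- The mean value `M(f) = lim_{T → ∞} (2T)⁻¹ ∫_{-T}^{T} f`; the limit exists for `f` in `AP`. -/
def meanValue (f : ℝ → ℂ) : ℂ :=
  limUnder atTop (fun T : ℝ => (1 / (2 * T : ℂ)) * ∫ t in (-T)..T, f t)

/-- The Bohr-Fourier coefficient of `f` at the frequency `μ`. -/
def bohrCoeff (f : ℝ → ℂ) (μ : ℝ) : ℂ := meanValue (fun x => e (-μ) x * f x)

/-- The Bohr-Fourier spectrum `Ω(f)`. -/
def spec (f : ℝ → ℂ) : Set ℝ := {μ | bohrCoeff f μ ≠ 0}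

/-- `AP^+`: the almost periodic functions with spectrum in `[0, ∞)`. -/
def APPlus : Set (ℝ → ℂ) := {f | f ∈ AP ∧ spec f ⊆ Set.Ici 0}

/-- `AP^-`: the almost periodic functions with spectrum in `(-∞, 0]`. -/
def APMinus : Set (ℝ → ℂ) := {f | f ∈ AP ∧ spec f ⊆ Set.Iic 0}

/-- `inf Ω(f)` in the extended reals (`+∞` if the spectrum is empty). -/
def infSpec (f : ℝ → ℂ) : EReal := sInf ((fun μ : ℝ => (μ : EReal)) '' spec f)

/-- `sup Ω(f)` in the extended reals (`-∞` if the spectrum is empty). -/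
def supSpec (f : ℝ → ℂ) : EReal := sSup ((fun μ : ℝ => (μ : EReal)) '' spec f)

/-- `g = a_- e_{-β} + a_+ e_ν` (a.e. on the line) with `a_± ∈ H_∞^±`, `0 ≤ ν, β ≤ λ` and
`ν + β > 0`. -/
structure IsRep (lam : ℝ) (g : ℝ → ℂ) (ν β : ℝ) (ap am : ℝ → ℂ) : Prop where
  ap_mem : ap ∈ HinfPlus
  am_mem : am ∈ HinfMinus
  ν_nonneg : 0 ≤ ν
  ν_le : ν ≤ lam
  β_nonneg : 0 ≤ β
  β_le : β ≤ lam
  sum_pos : 0 < ν + β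
  eq : ∀ᵐ x : ℝ, g x = am x * e (-β) x + ap x * e ν x

/-- The requirements `e_{β/(N-1)} a_- ∈ H_∞^+` and `e_{-ν/(N-1)} a_+ ∈ H_∞^-`
(used only for `N > 1`). -/
def BandLimited (N : ℕ) (ν β : ℝ) (ap am : ℝ → ℂ) : Prop :=
  (fun x => e (β / ((N : ℝ) - 1)) x * am x) ∈ HinfPlus ∧
  (fun x => e (-(ν / ((N : ℝ) - 1))) x * ap x) ∈ HinfMinus

/-- The class `S_{λ,N}`. The last clause says that `N` is the smallest value of `⌈λ/(ν+β)⌉`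
among all representations of `g`. -/
def S (lam : ℝ) (N : ℕ) : Set (ℝ → ℂ) :=
  {g | (∃ (ν β : ℝ) (ap am : ℝ → ℂ), IsRep lam g ν β ap am ∧ lam / (ν + β) = N ∧
        (1 < N → BandLimited N ν β ap am)) ∧
      ∀ (ν β : ℝ) (ap am : ℝ → ℂ), IsRep lam g ν β ap am → N ≤ ⌈lam / (ν + β)⌉₊}

/-- The conditions on the spectral endpoints for `N > 1`:
`N = ⌈λ/(η_{1-}+η_{1+})⌉`, `η_{1-} ≥ (N-1)/N η_{2-}`, `η_{1+} ≥ (N-1)/N η_{2+}` and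
`η_{2+}+η_{2-} ≤ λ/(N-1)`. Since `λ/∞ = 0` and `λ/0 = ∞`, the first equality with `N > 1`
entails that `η_{1-}+η_{1+}` is a positive real number `s`. -/
def EndpointConditions (lam : ℝ) (N : ℕ) (η1m η2m η1p η2p : EReal) : Prop :=
  (∃ s : ℝ, 0 < s ∧ η1m + η1p = (s : EReal) ∧ N = ⌈lam / s⌉₊) ∧
  (((((N : ℝ) - 1) / N : ℝ) : EReal) * η2m ≤ η1m) ∧
  (((((N : ℝ) - 1) / N : ℝ) : EReal) * η2p ≤ η1p) ∧
  (η2p + η2m ≤ ((lam / ((N : ℝ) - 1) : ℝ) : EReal))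

/-- `M = max {λ/N - η_{1-}, (N-1)/N η_{2+}}`. -/
def lowerBound (lam : ℝ) (N : ℕ) (η1m η2p : EReal) : EReal :=
  max (((lam / N : ℝ) : EReal) - η1m) (((((N : ℝ) - 1) / N : ℝ) : EReal) * η2p)

/-- `m = min {η_{1+}, (λ - (N-1) η_{2-})/N}`. -/
def upperBound (lam : ℝ) (N : ℕ) (η2m η1p : EReal) : EReal :=
  min η1p (((lam : EReal) - (((N : ℝ) - 1 : ℝ) : EReal) * η2m) / ((N : ℝ) : EReal))

end APGap

end

noncomputable section

namespace APGap

open Filter Topology MeasureTheory ComplexConjugate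

/-! A representation is determined by ν and β. If g = a_- e_{-β} + a_+ e_ν, then g_+ - e_ν a_+ =
e_{-β} a_- - g_- lies in both H_∞^+ and H_∞^-, so it is constant. One of ν, β is positive, and
taking means on that side, where 0 ∉ Ω(g_±), shows that the constant is 0. Hence a_+ = g_+ e_{-ν}
and a_- = g_- e_β almost everywhere (`IsRep.ae_eq`).

The second pillar is a dictionary (`spec_subset_Ici_iff`, `spec_subset_Iic_iff`): for f ∈ AP, Ω(f) ⊂
[ν, ∞) exactly when e_{-ν} f ∈ H_∞^+, and symmetrically. So (1) forces ν ≤ η_{1+} and β ≤ η_{1-},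
while (2) says η_{2+} ≤ νN/(N-1) and η_{2-} ≤ βN/(N-1). The attainable sums ν + β not exceeding λ
fill (0, min(λ, η_{1+} + η_{1-})], which determines the least ceiling. With ν + β = λ/N the
remaining inequalities become M ≤ ν ≤ m, and M ≤ m splits into four comparisons, all supplied by the
endpoint conditions.

For the dictionary, a positively modulated H_∞^+ function has mean zero by a contour argument.
Conversely, if f ∈ AP has nonnegative spectrum, its correlation with a kernel having both poles in
the lower half-plane has no Bohr-Fourier coefficients, so it vanishes by the uniqueness theorem.
This orthogonality makes the Cauchy integral of f equal to its Poisson integral, hence analytic,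
bounded, and with boundary values f. -/

lemma e_eq (μ x : ℝ) : e μ x = Complex.exp (((μ * x : ℝ) : ℂ) * Complex.I) := by
  unfold e; push_cast; ring_nf

@[simp] lemma norm_e (μ x : ℝ) : ‖e μ x‖ = 1 := by
  rw [e_eq]; exact Complex.norm_exp_ofReal_mul_I _

lemma e_add (a b x : ℝ) : e (a + b) x = e a x * e b x := by
  unfold e; rw [← Complex.exp_add]; push_cast; ring_nf

lemma e_add_arg (a x y : ℝ) : e a (x + y) = e a x * e a y := by
  unfold e; rw [← Complex.exp_add]; push_cast; ring_nf

@[simp] lemma e_zero (x : ℝ) : e 0 x = 1 := by simp [e]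

lemma e_neg_arg (a x : ℝ) : e a (-x) = e (-a) x := by
  unfold e; push_cast; ring_nf

lemma conj_e (a x : ℝ) : conj (e a x) = e (-a) x := by
  unfold e; rw [← Complex.exp_conj]; simp

lemma continuous_e (a : ℝ) : Continuous (e a) := by
  unfold e; fun_prop

/-! ### Averages over symmetric intervals -/

/-- The average of `f` over `[-T, T]`. -/
def avg (f : ℝ → ℂ) (T : ℝ) : ℂ := (1 / (2 * T : ℂ)) * ∫ t in (-T)..T, f t

lemma meanValue_eq_of_tendsto {f : ℝ → ℂ} {m : ℂ} (h : Tendsto (avg f) atTop (𝓝 m)) :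
    meanValue f = m := h.limUnder_eq

lemma norm_avg_le {f : ℝ → ℂ} {C T : ℝ} (hT : 0 < T) (h : ∀ x, ‖f x‖ ≤ C) :
    ‖avg f T‖ ≤ C := by
  have h1 : ‖∫ t in (-T)..T, f t‖ ≤ C * |T - -T| :=
    intervalIntegral.norm_integral_le_of_norm_le_const fun x _ => h x
  have h2 : |T - -T| = 2 * T := by rw [abs_of_pos (by linarith)]; ring
  unfold avg
  rw [norm_mul, norm_div, norm_mul, Complex.norm_real, Real.norm_of_nonneg hT.le]
  simp only [norm_one, Complex.norm_ofNat]
  rw [h2] at h1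
  calc 1 / (2 * T) * ‖∫ t in (-T)..T, f t‖ ≤ 1 / (2 * T) * (C * (2 * T)) := by gcongr
    _ = C := by field_simp

lemma avg_add {f g : ℝ → ℂ} (hf : Continuous f) (hg : Continuous g) (T : ℝ) :
    avg (fun x => f x + g x) T = avg f T + avg g T := by
  unfold avg
  rw [intervalIntegral.integral_add (hf.intervalIntegrable _ _) (hg.intervalIntegrable _ _)]
  ring

lemma avg_sub {f g : ℝ → ℂ} (hf : Continuous f) (hg : Continuous g) (T : ℝ) :
    avg (fun x => f x - g x) T = avg f T - avg g T := by
  unfold avg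
  rw [intervalIntegral.integral_sub (hf.intervalIntegrable _ _) (hg.intervalIntegrable _ _)]
  ring

lemma avg_const_mul (c : ℂ) (f : ℝ → ℂ) (T : ℝ) :
    avg (fun x => c * f x) T = c * avg f T := by
  unfold avg
  rw [intervalIntegral.integral_const_mul]
  ring

lemma avg_congr_ae {f g : ℝ → ℂ} (h : ∀ᵐ x : ℝ, f x = g x) (T : ℝ) : avg f T = avg g T := by
  unfold avg
  rw [intervalIntegral.integral_congr_ae (h.mono fun x hx _ => hx)]

lemma avg_comp_neg (f : ℝ → ℂ) (T : ℝ) : avg (fun x => f (-x)) T = avg f T := by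
  unfold avg
  rw [intervalIntegral.integral_comp_neg, neg_neg]

lemma avg_one {T : ℝ} (hT : 0 < T) : avg (fun _ => 1) T = 1 := by
  unfold avg
  have : (T : ℂ) ≠ 0 := by exact_mod_cast hT.ne'
  simp only [intervalIntegral.integral_const, sub_neg_eq_add, Complex.real_smul]
  push_cast
  field_simp
  ring

lemma tendsto_avg_zero : Tendsto (avg fun _ => 0) atTop (𝓝 0) :=
  tendsto_const_nhds.congr fun T => by simp [avg]

/-- The common source of vanishing means: it serves nontrivial exponentials, differences of
translates, and modulated Hardy functions. -/
lemma tendsto_avg_of_integral_bounded {f : ℝ → ℂ} {C : ℝ}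
    (h : ∀ T : ℝ, 0 < T → ‖∫ t in (-T)..T, f t‖ ≤ C) : Tendsto (avg f) atTop (𝓝 0) := by
  have h1 : Tendsto (fun T : ℝ => C / 2 * T⁻¹) atTop (𝓝 0) := by
    simpa using tendsto_inv_atTop_zero.const_mul (C / 2)
  refine squeeze_zero_norm' ?_ h1
  filter_upwards [eventually_gt_atTop 0] with T hT
  unfold avg
  rw [norm_mul, norm_div, norm_mul, Complex.norm_real, Real.norm_of_nonneg hT.le]
  simp only [norm_one, Complex.norm_ofNat]
  calc 1 / (2 * T) * ‖∫ t in (-T)..T, f t‖ ≤ 1 / (2 * T) * C := by gcongr; exact h T hT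
    _ = C / 2 * T⁻¹ := by field_simp

lemma tendsto_avg_e (μ : ℝ) : Tendsto (avg (e μ)) atTop (𝓝 (if μ = 0 then 1 else 0)) := by
  split_ifs with h
  · subst h
    have : e 0 = fun _ => 1 := by ext x; simp
    rw [this]
    refine tendsto_const_nhds.congr' ?_
    filter_upwards [eventually_gt_atTop 0] with T hT
    exact (avg_one hT).symm
  · have hc : Complex.I * (μ : ℂ) ≠ 0 := mul_ne_zero Complex.I_ne_zero (by exact_mod_cast h)
    refine tendsto_avg_of_integral_bounded (C := 2 / |μ|) fun T hT => ?_
    have : ∫ t in (-T)..T, e μ t = (e μ T - e μ (-T)) / (Complex.I * μ) := by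
      unfold e; rw [integral_exp_mul_complex hc]
    rw [this, norm_div]
    have h2 : ‖Complex.I * (μ : ℂ)‖ = |μ| := by simp
    rw [h2]
    gcongr
    calc ‖e μ T - e μ (-T)‖ ≤ ‖e μ T‖ + ‖e μ (-T)‖ := norm_sub_le _ _
      _ = 2 := by simp; norm_num

/-! ### Trigonometric polynomials and their uniform limits -/

/-- Trigonometric polynomials. -/
abbrev Trig : Submodule ℂ (ℝ → ℂ) := Submodule.span ℂ (Set.range e)

lemma Trig.induct {P : (ℝ → ℂ) → Prop} (he : ∀ μ, P (e μ)) (h0 : P (fun _ => 0))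
    (hadd : ∀ f ∈ Trig, ∀ g ∈ Trig, P f → P g → P (fun x => f x + g x))
    (hsmul : ∀ (c : ℂ), ∀ f ∈ Trig, P f → P (fun x => c * f x)) {p : ℝ → ℂ} (hp : p ∈ Trig) :
    P p := by
  induction hp using Submodule.span_induction with
  | mem x hx => obtain ⟨μ, rfl⟩ := hx; exact he μ
  | zero => exact h0
  | add f g hf hg h1 h2 => exact hadd f hf g hg h1 h2
  | smul c f hf h => exact hsmul c f hf h

lemma Trig.e_mem (μ : ℝ) : e μ ∈ Trig := Submodule.subset_span ⟨μ, rfl⟩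

lemma Trig.add_mem' {p q : ℝ → ℂ} (hp : p ∈ Trig) (hq : q ∈ Trig) :
    (fun x => p x + q x) ∈ Trig := Submodule.add_mem _ hp hq

lemma Trig.const_mul_mem (c : ℂ) {p : ℝ → ℂ} (hp : p ∈ Trig) :
    (fun x => c * p x) ∈ Trig := Submodule.smul_mem _ c hp

lemma Trig.zero_mem' : (fun _ => 0 : ℝ → ℂ) ∈ Trig := Submodule.zero_mem _

lemma Trig.continuous {p : ℝ → ℂ} (hp : p ∈ Trig) : Continuous p :=
  Trig.induct (P := Continuous) continuous_e continuous_const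
    (fun _ _ _ _ h1 h2 => h1.add h2) (fun _ _ _ h => continuous_const.mul h) hp

lemma Trig.bounded {p : ℝ → ℂ} (hp : p ∈ Trig) : ∃ C : ℝ, ∀ x, ‖p x‖ ≤ C := by
  refine Trig.induct (P := fun p => ∃ C : ℝ, ∀ x, ‖p x‖ ≤ C) (fun μ => ⟨1, fun x => by simp⟩)
    ⟨0, by simp⟩ ?_ ?_ hp
  · rintro f - g - ⟨C, hC⟩ ⟨D, hD⟩
    exact ⟨C + D, fun x => (norm_add_le _ _).trans (add_le_add (hC x) (hD x))⟩
  · rintro c f - ⟨C, hC⟩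
    exact ⟨‖c‖ * C, fun x => by rw [norm_mul]; gcongr; exact hC x⟩

lemma Trig.exists_mean {p : ℝ → ℂ} (hp : p ∈ Trig) : ∃ m, Tendsto (avg p) atTop (𝓝 m) := by
  refine Trig.induct (P := fun p => ∃ m, Tendsto (avg p) atTop (𝓝 m))
    (fun μ => ⟨_, tendsto_avg_e μ⟩) ⟨0, tendsto_avg_zero⟩
    ?_ ?_ hp
  · rintro f hf g hg ⟨m, hm⟩ ⟨n, hn⟩
    refine ⟨m + n, (hm.add hn).congr fun T => ?_⟩
    rw [avg_add (Trig.continuous hf) (Trig.continuous hg)]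
  · rintro c f - ⟨m, hm⟩
    refine ⟨c * m, (hm.const_mul c).congr fun T => ?_⟩
    rw [avg_const_mul]

lemma AP.of_approx {f : ℝ → ℂ} (C : ℝ)
    (h : ∀ ε : ℝ, 0 < ε → ∃ p ∈ Trig, ∀ x : ℝ, ‖f x - p x‖ ≤ C * ε) : f ∈ AP := by
  intro ε hε
  obtain ⟨p, hp, hp'⟩ := h (ε / (|C| + 1)) (by positivity)
  refine ⟨p, hp, fun x => (hp' x).trans ?_⟩
  have : C ≤ |C| + 1 := by linarith [le_abs_self C]
  calc C * (ε / (|C| + 1)) ≤ (|C| + 1) * (ε / (|C| + 1)) := by gcongr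
    _ = ε := by field_simp

lemma AP.continuous {f : ℝ → ℂ} (hf : f ∈ AP) : Continuous f := by
  refine continuous_of_uniform_approx_of_continuous fun u hu => ?_
  obtain ⟨ε, hε, h⟩ := Metric.mem_uniformity_dist.1 hu
  obtain ⟨p, hp, hp'⟩ := hf (ε / 2) (by positivity)
  exact ⟨p, Trig.continuous hp, fun x => h (by rw [dist_eq_norm]; linarith [hp' x])⟩

lemma AP.bounded {f : ℝ → ℂ} (hf : f ∈ AP) : ∃ C : ℝ, ∀ x, ‖f x‖ ≤ C := by
  obtain ⟨p, hp, hp'⟩ := hf 1 one_pos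
  obtain ⟨C, hC⟩ := Trig.bounded hp
  refine ⟨1 + C, fun x => ?_⟩
  calc ‖f x‖ = ‖(f x - p x) + p x‖ := by ring_nf
    _ ≤ 1 + C := (norm_add_le _ _).trans (add_le_add (hp' x) (hC x))

/-- Averaging is a contraction for the sup norm, so the Cauchy property of T ↦ `avg p T` passes from
trigonometric polynomials to uniform limits. -/
lemma AP.exists_mean {f : ℝ → ℂ} (hf : f ∈ AP) : ∃ m, Tendsto (avg f) atTop (𝓝 m) := by
  refine cauchySeq_tendsto_of_complete (Metric.cauchySeq_iff'.2 fun ε hε => ?_)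
  obtain ⟨p, hp, hp'⟩ := hf (ε / 8) (by positivity)
  obtain ⟨m, hm⟩ := Trig.exists_mean hp
  obtain ⟨N, hN⟩ := Metric.cauchySeq_iff'.1 hm.cauchySeq (ε / 4) (by positivity)
  have key : ∀ T : ℝ, 0 < T → ‖avg f T - avg p T‖ ≤ ε / 8 := fun T hT => by
    rw [← avg_sub (AP.continuous hf) (Trig.continuous hp)]
    exact norm_avg_le hT hp'
  have hN2 : ∀ n ≥ max N 1, ‖avg p n - avg p N‖ < ε / 4 := fun n hn => by
    rw [← dist_eq_norm]; exact hN n ((le_max_left _ _).trans hn)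
  -- The `1` keeps the intervals nondegenerate, as the contraction estimate needs T > 0.
  refine ⟨max N 1, fun n hn => ?_⟩
  have h1 := key n (lt_of_lt_of_le one_pos ((le_max_right _ _).trans hn))
  have h2 := key (max N 1) (lt_of_lt_of_le one_pos (le_max_right _ _))
  have h3 := hN2 n hn
  have h4 := hN2 (max N 1) le_rfl
  rw [dist_eq_norm]
  calc ‖avg f n - avg f (max N 1)‖ = ‖(avg f n - avg p n) - (avg f (max N 1) - avg p (max N 1))
        + (avg p n - avg p N) - (avg p (max N 1) - avg p N)‖ := by ring_nf
    _ ≤ ‖avg f n - avg p n‖ + ‖avg f (max N 1) - avg p (max N 1)‖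
        + ‖avg p n - avg p N‖ + ‖avg p (max N 1) - avg p N‖ :=
        (norm_sub_le _ _).trans (add_le_add_left ((norm_add_le _ _).trans
          (add_le_add_left (norm_sub_le _ _) _)) _)
    _ < ε := by linarith

lemma AP.tendsto_avg {f : ℝ → ℂ} (hf : f ∈ AP) : Tendsto (avg f) atTop (𝓝 (meanValue f)) := by
  obtain ⟨m, hm⟩ := AP.exists_mean hf
  rwa [meanValue_eq_of_tendsto hm]

lemma Trig.e_mul (a : ℝ) {p : ℝ → ℂ} (hp : p ∈ Trig) : (fun x => e a x * p x) ∈ Trig := by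
  refine Trig.induct (P := fun p => (fun x => e a x * p x) ∈ Trig) (fun μ => ?_) ?_ ?_ ?_ hp
  · have : (fun x => e a x * e μ x) = e (a + μ) := by ext x; rw [e_add]
    rw [this]; exact Trig.e_mem _
  · simpa using Trig.zero_mem'
  · intro f _ g _ h1 h2
    simpa [mul_add] using Trig.add_mem' h1 h2
  · intro c f _ h
    simpa [mul_left_comm] using Trig.const_mul_mem c h

lemma Trig.comp_neg {p : ℝ → ℂ} (hp : p ∈ Trig) : (fun x => p (-x)) ∈ Trig := by
  refine Trig.induct (P := fun p => (fun x => p (-x)) ∈ Trig) (fun μ => ?_) Trig.zero_mem'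
    (fun f _ g _ h1 h2 => Trig.add_mem' h1 h2) (fun c f _ h => Trig.const_mul_mem c h) hp
  have : (fun x => e μ (-x)) = e (-μ) := by ext x; rw [e_neg_arg]
  rw [this]; exact Trig.e_mem _

lemma AP.e_mul (a : ℝ) {f : ℝ → ℂ} (hf : f ∈ AP) : (fun x => e a x * f x) ∈ AP := by
  intro ε hε
  obtain ⟨p, hp, hp'⟩ := hf ε hε
  refine ⟨_, Trig.e_mul a hp, fun x => ?_⟩
  rw [← mul_sub, norm_mul, norm_e, one_mul]
  exact hp' x

lemma AP.comp_neg {f : ℝ → ℂ} (hf : f ∈ AP) : (fun x => f (-x)) ∈ AP := by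
  intro ε hε
  obtain ⟨p, hp, hp'⟩ := hf ε hε
  exact ⟨_, Trig.comp_neg hp, fun x => hp' (-x)⟩

lemma AP.tendsto_bohrCoeff {f : ℝ → ℂ} (hf : f ∈ AP) (μ : ℝ) :
    Tendsto (avg fun x => e (-μ) x * f x) atTop (𝓝 (bohrCoeff f μ)) :=
  AP.tendsto_avg (AP.e_mul _ hf)

lemma bohrCoeff_e_mul (a : ℝ) (f : ℝ → ℂ) (μ : ℝ) :
    bohrCoeff (fun x => e a x * f x) μ = bohrCoeff f (μ - a) := by
  unfold bohrCoeff
  congr 1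
  ext x
  rw [← mul_assoc, ← e_add]
  ring_nf

lemma bohrCoeff_comp_neg (f : ℝ → ℂ) (μ : ℝ) :
    bohrCoeff (fun x => f (-x)) μ = bohrCoeff f (-μ) := by
  unfold bohrCoeff
  have : avg (fun x => e (-μ) x * f (-x)) = avg (fun x => e (- -μ) x * f x) := by
    ext T
    rw [← avg_comp_neg]
    simp [e_neg_arg]
  change limUnder atTop (avg _) = limUnder atTop (avg _)
  rw [this]

lemma mem_spec_e_mul {a : ℝ} {f : ℝ → ℂ} {μ : ℝ} :
    μ ∈ spec (fun x => e a x * f x) ↔ μ - a ∈ spec f := by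
  simp [spec, bohrCoeff_e_mul]

lemma mem_spec_comp_neg {f : ℝ → ℂ} {μ : ℝ} :
    μ ∈ spec (fun x => f (-x)) ↔ -μ ∈ spec f := by
  simp [spec, bohrCoeff_comp_neg]

/-! ### Uniqueness of almost periodic functions -/

/-- The degenerate case of Parseval: f is orthogonal in mean to every trigonometric polynomial p,
and replacing one factor f by a uniformly close p changes the average of |f|² little. -/
lemma AP.tendsto_avg_mul_conj_self {f : ℝ → ℂ} (hf : f ∈ AP) (h0 : ∀ μ, bohrCoeff f μ = 0) :
    Tendsto (avg fun x => f x * conj (f x)) atTop (𝓝 0) := by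
  have hcf := AP.continuous hf
  have htrig : ∀ p ∈ Trig, Tendsto (avg fun x => f x * conj (p x)) atTop (𝓝 0) := by
    intro p hp
    refine Trig.induct (P := fun p => Tendsto (avg fun x => f x * conj (p x)) atTop (𝓝 0))
      (fun μ => ?_) ?_ ?_ ?_ hp
    · have := AP.tendsto_bohrCoeff hf μ
      rw [h0] at this
      simpa only [conj_e, mul_comm] using this
    · simpa using tendsto_avg_zero
    · intro p hp q hq h1 h2
      have := h1.add h2
      rw [add_zero] at this
      refine this.congr fun T => ?_
      have c1 := Trig.continuous hp
      have c2 := Trig.continuous hq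
      rw [← avg_add (by fun_prop) (by fun_prop)]
      simp [mul_add]
    · intro c p _ h
      have := h.const_mul (conj c)
      rw [mul_zero] at this
      refine this.congr fun T => ?_
      rw [← avg_const_mul]
      simp [mul_left_comm]
  obtain ⟨C, hC⟩ := AP.bounded hf
  have hC0 : 0 ≤ C := (norm_nonneg _).trans (hC 0)
  rw [Metric.tendsto_nhds]
  intro ε hε
  obtain ⟨p, hp, hp'⟩ := hf (ε / (2 * (C + 1))) (by positivity)
  have hcp := Trig.continuous hp
  filter_upwards [(Metric.tendsto_nhds.1 (htrig p hp)) (ε / 2) (by positivity),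
    eventually_gt_atTop 0] with T hT hT0
  have h1 : avg (fun x => f x * conj (f x)) T =
      avg (fun x => f x * conj (f x - p x)) T + avg (fun x => f x * conj (p x)) T := by
    rw [← avg_add (by fun_prop) (by fun_prop)]
    simp [← mul_add]
  have h2 : ‖avg (fun x => f x * conj (f x - p x)) T‖ ≤ C * (ε / (2 * (C + 1))) :=
    norm_avg_le hT0 fun x => by
      rw [norm_mul, RCLike.norm_conj]
      exact mul_le_mul (hC x) (hp' x) (norm_nonneg _) hC0
  have h3 : C * (ε / (2 * (C + 1))) ≤ ε / 2 := by
    rw [mul_div_assoc', div_le_div_iff₀ (by positivity) (by positivity)]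
    nlinarith
  rw [dist_zero_right] at hT ⊢
  rw [h1]
  linarith [norm_add_le (avg (fun x => f x * conj (f x - p x)) T)
    (avg (fun x => f x * conj (p x)) T)]

/-- The two integrals differ only over two end intervals of length |s|, so their difference stays
bounded in T. -/
lemma tendsto_avg_comp_add {u : ℝ → ℂ} (hu : Continuous u) {C : ℝ} (hC : ∀ x, ‖u x‖ ≤ C)
    {m : ℂ} (h : Tendsto (avg u) atTop (𝓝 m)) (s : ℝ) :
    Tendsto (avg fun x => u (x + s)) atTop (𝓝 m) := by
  have h2 : Tendsto (avg fun x => u (x + s) - u x) atTop (𝓝 0) := by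
    refine tendsto_avg_of_integral_bounded (C := C * |s| + C * |s|) fun T _ => ?_
    rw [intervalIntegral.integral_sub ((by fun_prop : Continuous _).intervalIntegrable _ _)
      (hu.intervalIntegrable _ _), intervalIntegral.integral_comp_add_right,
      intervalIntegral.integral_interval_sub_interval_comm (hu.intervalIntegrable _ _)
      (hu.intervalIntegrable _ _) (hu.intervalIntegrable _ _)]
    refine (norm_sub_le _ _).trans (add_le_add ?_ ?_)
    · refine (intervalIntegral.norm_integral_le_of_norm_le_const fun x _ => hC x).trans_eq ?_
      rw [abs_sub_comm]; ring_nf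
    · refine (intervalIntegral.norm_integral_le_of_norm_le_const fun x _ => hC x).trans_eq ?_
      rw [abs_sub_comm]; ring_nf
  have := h2.add h
  rw [zero_add] at this
  refine this.congr fun T => ?_
  rw [← avg_add (by fun_prop) hu]
  simp

/-- The translates of an almost periodic function are totally bounded. -/
lemma AP.exists_finite_translates {f : ℝ → ℂ} (hf : f ∈ AP) {ε : ℝ} (hε : 0 < ε) :
    ∃ A : Finset ℝ, ∀ t : ℝ, ∃ s ∈ A, ∀ x, ‖f (x + t) - f (x + s)‖ ≤ ε := by
  obtain ⟨p, hp, hp'⟩ := hf (ε / 4) (by positivity)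
  obtain ⟨c, hc⟩ := (Finsupp.mem_span_range_iff_exists_finsupp).1 hp
  set K : ℝ := ∑ μ ∈ c.support, ‖c μ‖ with hK
  have hK0 : 0 ≤ K := Finset.sum_nonneg fun _ _ => norm_nonneg _
  -- Since e_μ(x+t) = e_μ(x) e_μ(t), a translate of p is controlled uniformly in x by the finite
  -- vector Φ t, which stays in a compact ball.
  set Φ : ℝ → (c.support → ℂ) := fun t μ => e μ t with hΦ
  have htb : TotallyBounded (Set.range Φ) := by
    refine (isCompact_closedBall (0 : c.support → ℂ) 1).totallyBounded.subset ?_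
    rintro _ ⟨t, rfl⟩
    rw [mem_closedBall_zero_iff, pi_norm_le_iff_of_nonneg zero_le_one]
    intro μ
    simp [hΦ]
  -- The net is taken inside the range of Φ, so that its points come from actual translations.
  obtain ⟨S, hS, hSf, hcov⟩ := htb.exists_subset
    (Metric.dist_mem_uniformity (show 0 < ε / (4 * (K + 1)) by positivity))
  refine ⟨hSf.toFinset.image (Function.invFun Φ), fun t => ?_⟩
  obtain ⟨y, hy, hty⟩ := Set.mem_iUnion₂.1 (hcov ⟨t, rfl⟩)
  refine ⟨Function.invFun Φ y, Finset.mem_image_of_mem _ (hSf.mem_toFinset.2 hy), fun x => ?_⟩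
  have hy' : Φ (Function.invFun Φ y) = y := Function.invFun_eq (hS hy)
  set s := Function.invFun Φ y
  have hd : dist (Φ t) (Φ s) < ε / (4 * (K + 1)) := by rw [hy']; exact hty
  have hps : ‖p (x + t) - p (x + s)‖ ≤ ε / 4 := by
    have hpx : ∀ z, p z = ∑ μ ∈ c.support, c μ * e μ z := fun z => by
      rw [← hc, Finsupp.sum, Finset.sum_apply]
      rfl
    rw [hpx, hpx, ← Finset.sum_sub_distrib]
    calc ‖∑ μ ∈ c.support, (c μ * e μ (x + t) - c μ * e μ (x + s))‖
        ≤ ∑ μ ∈ c.support, ‖c μ‖ * (ε / (4 * (K + 1))) := by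
          refine norm_sum_le_of_le _ fun μ hμ => ?_
          have h1 := (dist_le_pi_dist (Φ t) (Φ s) ⟨μ, hμ⟩).trans hd.le
          rw [dist_eq_norm] at h1
          rw [e_add_arg, e_add_arg, ← mul_sub, ← mul_sub, norm_mul, norm_mul, norm_e, one_mul]
          gcongr
      _ = K * (ε / (4 * (K + 1))) := by rw [Finset.sum_mul]
      _ ≤ ε / 4 := by
          rw [mul_div_assoc', div_le_div_iff₀ (by positivity) (by positivity)]
          nlinarith
  calc ‖f (x + t) - f (x + s)‖
      = ‖(f (x + t) - p (x + t)) - (f (x + s) - p (x + s)) + (p (x + t) - p (x + s))‖ := by ring_nf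
    _ ≤ ‖f (x + t) - p (x + t)‖ + ‖f (x + s) - p (x + s)‖ + ‖p (x + t) - p (x + s)‖ :=
        (norm_add_le _ _).trans (add_le_add_left (norm_sub_le _ _) _)
    _ ≤ ε := by linarith [hp' (x + t), hp' (x + s)]

/-- An almost periodic function with vanishing Bohr-Fourier coefficients is zero. -/
lemma AP.eq_zero_of_bohrCoeff {f : ℝ → ℂ} (hf : f ∈ AP) (h0 : ∀ μ, bohrCoeff f μ = 0) (x₀ : ℝ) :
    f x₀ = 0 := by
  by_contra hne
  have hd : 0 < ‖f x₀‖ := norm_pos_iff.2 hne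
  obtain ⟨A, hA⟩ := AP.exists_finite_translates hf (show 0 < ‖f x₀‖ / 2 by positivity)
  have hcf := AP.continuous hf
  obtain ⟨C, hC⟩ := AP.bounded hf
  -- Every t is matched by some s ∈ A for which f(t + x₀ - s) is within ‖f x₀‖/2 of f(x₀). So v is
  -- bounded below by a positive constant, although each of its finitely many summands has mean
  -- zero.
  set v : ℝ → ℝ := fun t => ∑ s ∈ A, ‖f (t + (x₀ - s))‖ ^ 2 with hv
  have hvc : Continuous v := by fun_prop
  have hlow : ∀ t, (‖f x₀‖ / 2) ^ 2 ≤ v t := by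
    intro t
    obtain ⟨s, hs, h⟩ := hA t
    have h1 := h (x₀ - s)
    have h2 : ‖f x₀‖ / 2 ≤ ‖f (t + (x₀ - s))‖ := by
      rw [show x₀ - s + s = x₀ by ring, add_comm (x₀ - s)] at h1
      have := norm_sub_norm_le (f x₀) (f (t + (x₀ - s)))
      rw [norm_sub_rev] at this
      linarith
    calc (‖f x₀‖ / 2) ^ 2 ≤ ‖f (t + (x₀ - s))‖ ^ 2 := by gcongr
      _ ≤ v t := Finset.single_le_sum (f := fun s => ‖f (t + (x₀ - s))‖ ^ 2)
        (fun _ _ => by positivity) hs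
  have hlim : Tendsto (avg fun t => (v t : ℂ)) atTop (𝓝 0) := by
    have hall : ∀ B : Finset ℝ,
        Tendsto (avg fun t => ∑ s ∈ B, f (t + (x₀ - s)) * conj (f (t + (x₀ - s)))) atTop (𝓝 0) := by
      intro B
      induction B using Finset.induction_on with
      | empty => simpa using tendsto_avg_zero
      | insert s B hs ih =>
        have h1 := tendsto_avg_comp_add (u := fun x => f x * conj (f x)) (by fun_prop)
          (C := C * C) (fun x => by
            rw [norm_mul, RCLike.norm_conj]
            exact mul_le_mul (hC x) (hC x) (norm_nonneg _) ((norm_nonneg _).trans (hC x)))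
          (AP.tendsto_avg_mul_conj_self hf h0) (x₀ - s)
        have := h1.add ih
        rw [zero_add] at this
        refine this.congr fun T => ?_
        rw [← avg_add (by fun_prop) (by fun_prop)]
        simp only [Finset.sum_insert hs]
    refine (hall A).congr fun T => ?_
    congr 1
    ext t
    simp only [hv]
    push_cast
    exact Finset.sum_congr rfl fun s _ => Complex.mul_conj' _
  have hge : ∀ T : ℝ, 0 < T → (‖f x₀‖ / 2) ^ 2 ≤ ‖avg (fun t => (v t : ℂ)) T‖ := by
    intro T hT
    have h1 : ∫ t in (-T)..T, (‖f x₀‖ / 2) ^ 2 ≤ ∫ t in (-T)..T, v t :=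
      intervalIntegral.integral_mono_on (by linarith) (by simp) (hvc.intervalIntegrable _ _)
        fun t _ => hlow t
    simp only [intervalIntegral.integral_const, smul_eq_mul] at h1
    have h2 : avg (fun t => (v t : ℂ)) T = ((1 / (2 * T) * ∫ t in (-T)..T, v t : ℝ) : ℂ) := by
      unfold avg
      rw [intervalIntegral.integral_ofReal]
      push_cast
      rfl
    rw [h2, Complex.norm_real]
    refine le_trans ?_ (le_abs_self _)
    rw [one_div, inv_mul_eq_div, le_div_iff₀ (by positivity)]
    linarith
  have := ge_of_tendsto hlim.norm (by
    filter_upwards [eventually_gt_atTop 0] with T hT using hge T hT)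
  rw [norm_zero] at this
  have : 0 < (‖f x₀‖ / 2) ^ 2 := by positivity
  linarith

/-! ### Bounded analytic functions in the upper half-plane -/

/-- The open upper half-plane. -/
abbrev upper : Set ℂ := {z : ℂ | 0 < z.im}

lemma isOpen_upper : IsOpen upper := isOpen_lt continuous_const Complex.continuous_im

/-- Cauchy's theorem on a rectangle, in the form used below: estimates on the top and lateral sides
control the bottom. -/
lemma norm_integral_bottom_le {g : ℂ → ℂ} (hg : DifferentiableOn ℂ g upper) {R y Y : ℝ}
    (hy : 0 < y) (hY : y ≤ Y) :
    ‖∫ x : ℝ in (-R)..R, g (x + y * Complex.I)‖ ≤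
      ‖∫ x : ℝ in (-R)..R, g (x + Y * Complex.I)‖ +
      ‖∫ t : ℝ in y..Y, g ((R : ℝ) + t * Complex.I)‖ +
      ‖∫ t : ℝ in y..Y, g ((-R : ℝ) + t * Complex.I)‖ := by
  have h := Complex.integral_boundary_rect_eq_zero_of_differentiableOn g
    ⟨-R, y⟩ ⟨R, Y⟩ (hg.mono fun z hz => by
      have := (Complex.mem_reProdIm.1 hz).2
      simp only [Set.uIcc_of_le hY] at this
      exact lt_of_lt_of_le hy this.1)
  simp only at h
  have h2 : (∫ x : ℝ in (-R)..R, g (x + y * Complex.I)) =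
      (∫ x : ℝ in (-R)..R, g (x + Y * Complex.I)) -
      Complex.I • (∫ t : ℝ in y..Y, g ((R : ℝ) + t * Complex.I)) +
      Complex.I • (∫ t : ℝ in y..Y, g ((-R : ℝ) + t * Complex.I)) := by
    linear_combination h
  rw [h2]
  refine (norm_add_le _ _).trans (add_le_add ((norm_sub_le _ _).trans (add_le_add le_rfl ?_)) ?_)
  all_goals rw [norm_smul, Complex.norm_I, one_mul]

lemma ofReal_sub_ne_zero {w : ℂ} (hw : w.im ≠ 0) (x : ℝ) : (x : ℂ) - w ≠ 0 := by
  intro h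
  have := congrArg Complex.im h
  simp at this
  exact hw this

lemma exists_one_add_sq_le {w : ℂ} (hw : w.im ≠ 0) :
    ∃ K : ℝ, 0 < K ∧ ∀ x : ℝ, (‖(x : ℂ) - w‖ ^ 2)⁻¹ ≤ K * (1 + x ^ 2)⁻¹ := by
  -- With w = a + ib, this constant comes from x² ≤ 2(x-a)² + 2a² and from b² ≤ |x-w|².
  refine ⟨2 + (1 + 2 * w.re ^ 2) / w.im ^ 2, by positivity, fun x => ?_⟩
  have hn : ‖(x : ℂ) - w‖ ^ 2 = (x - w.re) ^ 2 + w.im ^ 2 := by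
    rw [← Complex.normSq_eq_norm_sq, Complex.normSq_apply]
    simp
    ring
  have hp : 0 < w.im ^ 2 := by positivity
  rw [hn, ← div_eq_mul_inv, inv_le_comm₀ (by positivity) (by positivity), inv_div,
    div_le_iff₀ (by positivity)]
  have h1 : ((x - w.re) ^ 2 + w.im ^ 2) * (2 + (1 + 2 * w.re ^ 2) / w.im ^ 2) =
      2 * (x - w.re) ^ 2 + 2 * w.im ^ 2 + (1 + 2 * w.re ^ 2)
        + (x - w.re) ^ 2 * ((1 + 2 * w.re ^ 2) / w.im ^ 2) := by
    field_simp
    ring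
  rw [h1]
  have : 0 ≤ (x - w.re) ^ 2 * ((1 + 2 * w.re ^ 2) / w.im ^ 2) := by positivity
  nlinarith [sq_nonneg (x - 2 * w.re)]

lemma continuous_kernel {w w' : ℂ} (hw : w.im ≠ 0) (hw' : w'.im ≠ 0) :
    Continuous fun x : ℝ => (((x : ℂ) - w) * (x - w'))⁻¹ :=
  Continuous.inv₀ (by fun_prop) fun x =>
    mul_ne_zero (ofReal_sub_ne_zero hw x) (ofReal_sub_ne_zero hw' x)

lemma integrable_kernel {w w' : ℂ} (hw : w.im ≠ 0) (hw' : w'.im ≠ 0) :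
    Integrable fun x : ℝ => (((x : ℂ) - w) * (x - w'))⁻¹ := by
  obtain ⟨K, hK0, hK⟩ := exists_one_add_sq_le hw
  obtain ⟨K', hK0', hK'⟩ := exists_one_add_sq_le hw'
  refine (integrable_inv_one_add_sq.const_mul (K + K')).mono'
    (continuous_kernel hw hw').aestronglyMeasurable (Eventually.of_forall fun x => ?_)
  have h1 := hK x
  have h2 := hK' x
  rw [norm_inv, norm_mul, mul_inv]
  rw [← inv_pow] at h1 h2
  nlinarith [sq_nonneg (‖(x : ℂ) - w‖⁻¹ - ‖(x : ℂ) - w'‖⁻¹), norm_nonneg ((x : ℂ) - w)]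

lemma im_add_mul_I (x y : ℝ) : ((x : ℂ) + y * Complex.I).im = y := by simp

/-- The boundary function is an a.e. limit of the continuous functions x ↦ F(x + i/(n+1)). -/
lemma HinfPlus.aestronglyMeasurable {a : ℝ → ℂ} (ha : a ∈ HinfPlus) :
    AEStronglyMeasurable a := by
  obtain ⟨F, hF, -, hlim⟩ := ha
  have hseq : Tendsto (fun n : ℕ => 1 / ((n : ℝ) + 1)) atTop (𝓝[>] 0) :=
    tendsto_nhdsWithin_iff.2 ⟨tendsto_one_div_add_atTop_nhds_zero_nat,
      Eventually.of_forall fun n => by simp only [Set.mem_Ioi]; positivity⟩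
  refine aestronglyMeasurable_of_tendsto_ae atTop
    (f := fun (n : ℕ) (x : ℝ) => F (x + ((1 / ((n : ℝ) + 1) : ℝ) : ℂ) * Complex.I)) (fun n => ?_)
    (hlim.mono fun x hx => hx.comp hseq)
  refine Continuous.aestronglyMeasurable ?_
  refine hF.continuousOn.comp_continuous (by fun_prop) fun x => ?_
  have : 0 < 1 / ((n : ℝ) + 1) := by positivity
  simpa only [Set.mem_ofPred_eq, im_add_mul_I] using this

lemma HinfPlus.ae_bounded {a : ℝ → ℂ} (ha : a ∈ HinfPlus) : ∃ C : ℝ, ∀ᵐ x : ℝ, ‖a x‖ ≤ C := by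
  obtain ⟨F, -, ⟨C, hC⟩, hlim⟩ := ha
  refine ⟨C, hlim.mono fun x hx => le_of_tendsto hx.norm ?_⟩
  filter_upwards [self_mem_nhdsWithin] with y hy
  exact hC _ (by simpa using hy)

/-- Moving up moves away from a pole below; this gives domination uniform in the height y. -/
lemma norm_sub_le_norm_shift_sub {w : ℂ} (hw : w.im < 0) (x : ℝ) {y : ℝ} (hy : 0 < y) :
    ‖(x : ℂ) - w‖ ≤ ‖(x : ℂ) + y * Complex.I - w‖ := by
  refine abs_le_of_sq_le_sq' ?_ (norm_nonneg _) |>.2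
  rw [← Complex.normSq_eq_norm_sq, ← Complex.normSq_eq_norm_sq, Complex.normSq_apply,
    Complex.normSq_apply]
  simp
  nlinarith

lemma sub_ne_zero_of_im {z w : ℂ} (h : z.im ≠ w.im) : z - w ≠ 0 := by
  intro h'
  exact h (congrArg Complex.im (sub_eq_zero.1 h'))

/-- The contour is closed upwards by a rectangle of height R. With two poles the integrand is O(R⁻²)
on sides of total length 4R, so boundedness of F suffices. -/
lemma integral_shift_kernel_eq_zero {F : ℂ → ℂ} (hF : DifferentiableOn ℂ F upper) {C : ℝ}
    (hC : ∀ z : ℂ, 0 < z.im → ‖F z‖ ≤ C) {w w' : ℂ} (hw : w.im < 0) (hw' : w'.im < 0) {y : ℝ}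
    (hy : 0 < y) :
    ∫ x : ℝ, F (x + y * Complex.I) *
      (((x : ℂ) + y * Complex.I - w) * (x + y * Complex.I - w'))⁻¹ = 0 := by
  set g : ℂ → ℂ := fun z => F z * ((z - w) * (z - w'))⁻¹ with hg
  have hgd : DifferentiableOn ℂ g upper := by
    refine hF.mul (DifferentiableOn.inv (by fun_prop) fun z hz => ?_)
    have hz' : 0 < z.im := hz
    exact mul_ne_zero (sub_ne_zero_of_im (by linarith)) (sub_ne_zero_of_im (by linarith))
  have hC0 : 0 ≤ C := (norm_nonneg _).trans (hC Complex.I (by simp))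
  have hint : Integrable fun x : ℝ => g (x + y * Complex.I) := by
    refine ((integrable_kernel hw.ne hw'.ne).norm.const_mul C).mono' ?_
      (Eventually.of_forall fun x => ?_)
    · exact (hgd.continuousOn.comp_continuous (by fun_prop) fun x => by simpa using hy).aestronglyMeasurable
    · simp only [hg, norm_mul, norm_inv]
      have h1 := norm_sub_le_norm_shift_sub hw x hy
      have h2 := norm_sub_le_norm_shift_sub hw' x hy
      have h3 := norm_pos_iff.2 (ofReal_sub_ne_zero hw.ne x)
      have h4 := norm_pos_iff.2 (ofReal_sub_ne_zero hw'.ne x)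
      gcongr
      exact hC _ (by simpa using hy)
  have hlim := intervalIntegral_tendsto_integral hint tendsto_neg_atTop_atBot tendsto_id
  refine tendsto_nhds_unique hlim ?_
  set r := max ‖w‖ ‖w'‖ with hr
  have hfar : ∀ R : ℝ, 0 < R → 2 * r ≤ R → ∀ z : ℂ, 0 < z.im → R ≤ ‖z‖ →
      ‖g z‖ ≤ 4 * C / R ^ 2 := by
    intro R hR hrR z hz hz'
    have h1 : R / 2 ≤ ‖z - w‖ := by
      linarith [norm_sub_norm_le z w, le_max_left ‖w‖ ‖w'‖]
    have h2 : R / 2 ≤ ‖z - w'‖ := by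
      linarith [norm_sub_norm_le z w', le_max_right ‖w‖ ‖w'‖]
    simp only [hg, norm_mul, norm_inv]
    calc ‖F z‖ * (‖z - w‖ * ‖z - w'‖)⁻¹ ≤ C * (R / 2 * (R / 2))⁻¹ := by
          gcongr
          exact hC z hz
      _ = 4 * C / R ^ 2 := by field_simp; ring
  have hz0 : Tendsto (fun R : ℝ => 16 * C * R⁻¹) atTop (𝓝 0) := by
    simpa using tendsto_inv_atTop_zero.const_mul (16 * C)
  refine squeeze_zero_norm' ?_ hz0
  filter_upwards [eventually_gt_atTop 0, eventually_ge_atTop (2 * r)] with R hR hrR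
  refine (norm_integral_bottom_le hgd hy (Y := y + R) (by linarith)).trans ?_
  have e1 : ‖∫ x : ℝ in (-R)..R, g (x + ((y + R : ℝ) : ℂ) * Complex.I)‖ ≤
      4 * C / R ^ 2 * |R - -R| := by
    refine intervalIntegral.norm_integral_le_of_norm_le_const fun x _ => hfar R hR hrR _ ?_ ?_
    · rw [im_add_mul_I]; positivity
    · refine le_trans ?_ (Complex.abs_im_le_norm _)
      rw [im_add_mul_I, abs_of_pos (by positivity)]; linarith
  have e2 : ∀ s : ℝ, |s| = R → ‖∫ t : ℝ in y..(y + R), g ((s : ℂ) + t * Complex.I)‖ ≤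
      4 * C / R ^ 2 * |y + R - y| := by
    intro s hs
    refine intervalIntegral.norm_integral_le_of_norm_le_const fun t ht => hfar R hR hrR _ ?_ ?_
    · rw [Set.uIoc_of_le (by linarith)] at ht
      rw [im_add_mul_I]; linarith [ht.1]
    · refine le_trans ?_ (Complex.abs_re_le_norm _)
      simp [hs]
  have e3 := e2 R (abs_of_pos hR)
  have e4 := e2 (-R) (by rw [abs_neg, abs_of_pos hR])
  rw [add_sub_cancel_left, abs_of_pos hR] at e3 e4
  rw [abs_of_pos (by linarith)] at e1
  calc _ ≤ 4 * C / R ^ 2 * (R - -R) + 4 * C / R ^ 2 * R + 4 * C / R ^ 2 * R :=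
        add_le_add (add_le_add e1 e3) e4
    _ = 16 * C * R⁻¹ := by field_simp; ring

/-- Functions of class `H_∞^+` are orthogonal to the kernels with poles in the lower half-plane. -/
lemma HinfPlus.integral_kernel_eq_zero {a : ℝ → ℂ} (ha : a ∈ HinfPlus) {w w' : ℂ}
    (hw : w.im < 0) (hw' : w'.im < 0) :
    ∫ x : ℝ, a x * (((x : ℂ) - w) * (x - w'))⁻¹ = 0 := by
  obtain ⟨F, hF, ⟨C, hC⟩, hlim⟩ := ha
  have hC0 : 0 ≤ C := (norm_nonneg _).trans (hC Complex.I (by simp))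
  have key : Tendsto (fun y : ℝ => ∫ x : ℝ, F (x + y * Complex.I) *
      (((x : ℂ) + y * Complex.I - w) * (x + y * Complex.I - w'))⁻¹) (𝓝[>] 0)
      (𝓝 (∫ x : ℝ, a x * (((x : ℂ) - w) * (x - w'))⁻¹)) := by
    refine tendsto_integral_filter_of_dominated_convergence
      (fun x => C * ‖(((x : ℂ) - w) * (x - w'))⁻¹‖) ?_ ?_
      ((integrable_kernel hw.ne hw'.ne).norm.const_mul C) ?_
    · filter_upwards [self_mem_nhdsWithin] with y hy
      have hy' : 0 < y := hy
      refine Continuous.aestronglyMeasurable (Continuous.mul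
        (hF.continuousOn.comp_continuous (by fun_prop) fun x => by simpa using hy')
        (Continuous.inv₀ (by fun_prop) fun x => mul_ne_zero ?_ ?_))
      · exact sub_ne_zero_of_im (by rw [im_add_mul_I]; linarith)
      · exact sub_ne_zero_of_im (by rw [im_add_mul_I]; linarith)
    · filter_upwards [self_mem_nhdsWithin] with y hy
      have hy' : 0 < y := hy
      refine Eventually.of_forall fun x => ?_
      simp only [norm_mul, norm_inv]
      have h1 := norm_sub_le_norm_shift_sub hw x hy'
      have h2 := norm_sub_le_norm_shift_sub hw' x hy'
      have h3 := norm_pos_iff.2 (ofReal_sub_ne_zero hw.ne x)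
      have h4 := norm_pos_iff.2 (ofReal_sub_ne_zero hw'.ne x)
      gcongr
      exact hC _ (by simpa using hy')
    · filter_upwards [hlim] with x hx
      refine hx.mul (Tendsto.inv₀ ?_
        (mul_ne_zero (ofReal_sub_ne_zero hw.ne x) (ofReal_sub_ne_zero hw'.ne x)))
      have : Continuous fun y : ℝ => ((x : ℂ) + y * Complex.I - w) * (x + y * Complex.I - w') := by
        fun_prop
      simpa using (this.tendsto 0).mono_left nhdsWithin_le_nhds
  refine tendsto_nhds_unique key (tendsto_const_nhds.congr' ?_)
  filter_upwards [self_mem_nhdsWithin] with y hy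
  exact (integral_shift_kernel_eq_zero hF hC hw hw' hy).symm

/-! ### Algebra of the Hardy classes -/

/-- The map z ↦ -z exchanges the half-planes, so facts about H_∞^- follow from those about H_∞^+. -/
lemma mem_HinfMinus_iff {f : ℝ → ℂ} : f ∈ HinfMinus ↔ (fun x => f (-x)) ∈ HinfPlus := by
  have haeneg : ∀ {P : ℝ → Prop}, (∀ᵐ x : ℝ, P x) → ∀ᵐ x : ℝ, P (-x) := fun {P} h =>
    (Measure.measurePreserving_neg (volume : Measure ℝ)).quasiMeasurePreserving.ae h
  have hneg1 : Tendsto (fun y : ℝ => -y) (𝓝[>] 0) (𝓝[<] 0) := by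
    simpa using tendsto_neg_nhdsGT (a := (0 : ℝ))
  have hneg2 : Tendsto (fun y : ℝ => -y) (𝓝[<] 0) (𝓝[>] 0) := by
    simpa using tendsto_neg_nhdsLT (a := (0 : ℝ))
  constructor
  · rintro ⟨F, hF, ⟨C, hC⟩, hlim⟩
    refine ⟨fun z => F (-z), hF.comp (by fun_prop) fun z hz => ?_, ⟨C, fun z hz => hC _ ?_⟩, ?_⟩
    · simpa using hz
    · simpa using hz
    · filter_upwards [haeneg hlim] with x hx
      refine (hx.comp hneg1).congr fun y => ?_
      simp only [Function.comp]
      congr 1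
      push_cast
      ring
  · rintro ⟨F, hF, ⟨C, hC⟩, hlim⟩
    refine ⟨fun z => F (-z), hF.comp (by fun_prop) fun z hz => ?_, ⟨C, fun z hz => hC _ ?_⟩, ?_⟩
    · simpa using hz
    · simpa using hz
    · filter_upwards [haeneg hlim] with x hx
      rw [neg_neg] at hx
      refine (hx.comp hneg2).congr fun y => ?_
      simp only [Function.comp]
      congr 1
      push_cast
      ring

lemma HinfPlus.congr_ae {f g : ℝ → ℂ} (hf : f ∈ HinfPlus) (h : ∀ᵐ x : ℝ, f x = g x) :
    g ∈ HinfPlus := by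
  obtain ⟨F, hF, hC, hlim⟩ := hf
  refine ⟨F, hF, hC, ?_⟩
  filter_upwards [hlim, h] with x hx hx'
  rwa [← hx']

lemma HinfPlus.mul {f g : ℝ → ℂ} (hf : f ∈ HinfPlus) (hg : g ∈ HinfPlus) :
    (fun x => f x * g x) ∈ HinfPlus := by
  obtain ⟨F, hF, ⟨C, hC⟩, hlim⟩ := hf
  obtain ⟨G, hG, ⟨D, hD⟩, hlim'⟩ := hg
  refine ⟨fun z => F z * G z, hF.mul hG, ⟨C * D, fun z hz => ?_⟩, ?_⟩
  · rw [norm_mul]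
    exact mul_le_mul (hC z hz) (hD z hz) (norm_nonneg _) ((norm_nonneg _).trans (hC z hz))
  · filter_upwards [hlim, hlim'] with x hx hx'
    exact hx.mul hx'

lemma HinfPlus.sub {f g : ℝ → ℂ} (hf : f ∈ HinfPlus) (hg : g ∈ HinfPlus) :
    (fun x => f x - g x) ∈ HinfPlus := by
  obtain ⟨F, hF, ⟨C, hC⟩, hlim⟩ := hf
  obtain ⟨G, hG, ⟨D, hD⟩, hlim'⟩ := hg
  refine ⟨fun z => F z - G z, hF.sub hG, ⟨C + D, fun z hz => ?_⟩, ?_⟩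
  · exact (norm_sub_le _ _).trans (add_le_add (hC z hz) (hD z hz))
  · filter_upwards [hlim, hlim'] with x hx hx'
    exact hx.sub hx'

lemma HinfMinus.congr_ae {f g : ℝ → ℂ} (hf : f ∈ HinfMinus) (h : ∀ᵐ x : ℝ, f x = g x) :
    g ∈ HinfMinus := by
  obtain ⟨F, hF, hC, hlim⟩ := hf
  refine ⟨F, hF, hC, ?_⟩
  filter_upwards [hlim, h] with x hx hx'
  rwa [← hx']

lemma HinfMinus.mul {f g : ℝ → ℂ} (hf : f ∈ HinfMinus) (hg : g ∈ HinfMinus) :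
    (fun x => f x * g x) ∈ HinfMinus := by
  rw [mem_HinfMinus_iff] at *
  exact HinfPlus.mul hf hg

lemma HinfMinus.sub {f g : ℝ → ℂ} (hf : f ∈ HinfMinus) (hg : g ∈ HinfMinus) :
    (fun x => f x - g x) ∈ HinfMinus := by
  rw [mem_HinfMinus_iff] at *
  exact HinfPlus.sub hf hg

lemma norm_exp_I_mul (δ : ℝ) (z : ℂ) :
    ‖Complex.exp (Complex.I * δ * z)‖ = Real.exp (-(δ * z.im)) := by
  rw [Complex.norm_exp]
  simp

lemma e_mem_HinfPlus {μ : ℝ} (hμ : 0 ≤ μ) : e μ ∈ HinfPlus := by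
  refine ⟨fun z => Complex.exp (Complex.I * μ * z), by fun_prop, ⟨1, fun z hz => ?_⟩, ?_⟩
  · rw [norm_exp_I_mul]
    exact Real.exp_le_one_iff.2 (by nlinarith)
  · refine Eventually.of_forall fun x => ?_
    have : Continuous fun y : ℝ => Complex.exp (Complex.I * μ * (x + y * Complex.I)) := by fun_prop
    simpa [e] using (this.tendsto 0).mono_left nhdsWithin_le_nhds

lemma e_mem_HinfMinus {μ : ℝ} (hμ : μ ≤ 0) : e μ ∈ HinfMinus := by
  rw [mem_HinfMinus_iff]
  simpa only [e_neg_arg] using e_mem_HinfPlus (neg_nonneg.2 hμ)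

/-! ### Means of functions of class `H_∞^+` -/

/-- A positively modulated function of class `H_∞^+` has mean zero. -/
lemma HinfPlus.tendsto_avg_e_mul {a : ℝ → ℂ} (ha : a ∈ HinfPlus) {δ : ℝ} (hδ : 0 < δ) :
    Tendsto (avg fun x => e δ x * a x) atTop (𝓝 0) := by
  obtain ⟨F, hF, ⟨C, hC⟩, hlim⟩ := ha
  have hC0 : 0 ≤ C := (norm_nonneg _).trans (hC Complex.I (by simp))
  -- The bound is independent of T: each vertical side contributes at most C ∫ exp(-δt) dt ≤ C/δ,
  -- and the top side disappears as Y → ∞.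
  refine tendsto_avg_of_integral_bounded (C := 2 * C / δ) fun T hT => ?_
  set g : ℂ → ℂ := fun z => Complex.exp (Complex.I * δ * z) * F z with hg
  have hgd : DifferentiableOn ℂ g upper := DifferentiableOn.mul (by fun_prop) hF
  have hgb : ∀ z : ℂ, 0 < z.im → ‖g z‖ ≤ C * Real.exp (-(δ * z.im)) := by
    intro z hz
    simp only [hg]
    rw [norm_mul, norm_exp_I_mul, mul_comm]
    gcongr
    exact hC z hz
  have hside : ∀ y Y : ℝ, 0 < y → y ≤ Y → ∀ s : ℝ,
      ‖∫ t : ℝ in y..Y, g ((s : ℂ) + t * Complex.I)‖ ≤ C / δ := by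
    intro y Y hy hY s
    have h1 : ‖∫ t : ℝ in y..Y, g ((s : ℂ) + t * Complex.I)‖ ≤
        ∫ t in y..Y, C * Real.exp (-(δ * t)) := by
      refine intervalIntegral.norm_integral_le_of_norm_le hY (Eventually.of_forall fun t ht => ?_)
        ((by fun_prop : Continuous fun t => C * Real.exp (-(δ * t))).intervalIntegrable _ _)
      have := hgb (s + t * Complex.I) (by rw [im_add_mul_I]; linarith [ht.1])
      rwa [im_add_mul_I] at this
    refine h1.trans ?_
    have h2 : ∀ t ∈ Set.uIcc y Y, HasDerivAt (fun t => -(C / δ) * Real.exp (-(δ * t)))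
        (C * Real.exp (-(δ * t))) t := by
      intro t _
      have h3 : HasDerivAt (fun t => -(δ * t)) (-(δ * 1)) t := ((hasDerivAt_id' t).const_mul δ).neg
      refine (h3.exp.const_mul (-(C / δ))).congr_deriv ?_
      field_simp
    rw [intervalIntegral.integral_eq_sub_of_hasDerivAt h2
      ((by fun_prop : Continuous fun t => C * Real.exp (-(δ * t))).intervalIntegrable _ _)]
    have h3 : Real.exp (-(δ * y)) ≤ 1 := Real.exp_le_one_iff.2 (by nlinarith)
    have h4 := Real.exp_pos (-(δ * Y))
    have h5 : 0 ≤ C / δ := by positivity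
    nlinarith
  have hy : ∀ y : ℝ, 0 < y → ‖∫ x : ℝ in (-T)..T, g (x + y * Complex.I)‖ ≤ 2 * C / δ := by
    intro y hy
    have hY : ∀ Y : ℝ, y ≤ Y → ‖∫ x : ℝ in (-T)..T, g (x + y * Complex.I)‖ ≤
        C * Real.exp (-(δ * Y)) * (2 * T) + C / δ + C / δ := by
      intro Y hY
      refine (norm_integral_bottom_le hgd hy hY).trans
        (add_le_add (add_le_add ?_ (hside y Y hy hY _)) (hside y Y hy hY _))
      have : |T - -T| = 2 * T := by rw [abs_of_pos (by linarith)]; ring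
      rw [← this]
      refine intervalIntegral.norm_integral_le_of_norm_le_const fun x _ => ?_
      have := hgb (x + Y * Complex.I) (by rw [im_add_mul_I]; linarith)
      rwa [im_add_mul_I] at this
    have hlimY : Tendsto (fun Y : ℝ => C * Real.exp (-(δ * Y)) * (2 * T) + C / δ + C / δ) atTop
        (𝓝 (C * 0 * (2 * T) + C / δ + C / δ)) := by
      have : Tendsto (fun Y : ℝ => Real.exp (-(δ * Y))) atTop (𝓝 0) :=
        Real.tendsto_exp_neg_atTop_nhds_zero.comp (tendsto_id.const_mul_atTop hδ)
      exact (((this.const_mul C).mul_const _).add_const _).add_const _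
    have := ge_of_tendsto hlimY (by
      filter_upwards [eventually_ge_atTop y] with Y h using hY Y h)
    refine this.trans_eq ?_
    ring
  have hlimy : Tendsto (fun y : ℝ => ∫ x : ℝ in (-T)..T, g (x + y * Complex.I)) (𝓝[>] 0)
      (𝓝 (∫ x in (-T)..T, e δ x * a x)) := by
    refine intervalIntegral.tendsto_integral_filter_of_dominated_convergence (fun _ => C) ?_ ?_
      (by simp) ?_
    · filter_upwards [self_mem_nhdsWithin] with y hy
      have hy' : 0 < y := hy
      exact (hgd.continuousOn.comp_continuous (by fun_prop) fun x => by
        simpa using hy').aestronglyMeasurable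
    · filter_upwards [self_mem_nhdsWithin] with y hy
      have hy' : 0 < y := hy
      refine Eventually.of_forall fun x _ => ?_
      refine (hgb _ (by simpa using hy')).trans ?_
      rw [im_add_mul_I]
      exact mul_le_of_le_one_right hC0 (Real.exp_le_one_iff.2 (by nlinarith))
    · filter_upwards [hlim] with x hx _
      refine Tendsto.mul ?_ hx
      have : Continuous fun y : ℝ => Complex.exp (Complex.I * δ * (x + y * Complex.I)) := by
        fun_prop
      simpa [e] using (this.tendsto 0).mono_left nhdsWithin_le_nhds
  refine le_of_tendsto hlimy.norm ?_
  filter_upwards [self_mem_nhdsWithin] with y h using hy y h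

/-! ### Cauchy and Poisson kernels, and the intersection of the two Hardy classes -/

lemma integrable_mul_kernel {f : ℝ → ℂ} (hf : AEStronglyMeasurable f) {C : ℝ}
    (hC : ∀ᵐ x : ℝ, ‖f x‖ ≤ C) {w w' : ℂ} (hw : w.im ≠ 0) (hw' : w'.im ≠ 0) :
    Integrable fun x : ℝ => f x * (((x : ℂ) - w) * (x - w'))⁻¹ :=
  (integrable_kernel hw hw').bdd_mul hf hC

/-- Partial fractions: (z-a)/((x-z)(x-a)) = 1/(x-z) - 1/(x-a). Changing the auxiliary pole from a to
b therefore costs only an integral against the kernel with poles a, b. -/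
lemma kernel_cocycle {f : ℝ → ℂ} (hf : AEStronglyMeasurable f) {C : ℝ}
    (hC : ∀ᵐ x : ℝ, ‖f x‖ ≤ C) {z a b : ℂ} (hz : z.im ≠ 0) (ha : a.im ≠ 0) (hb : b.im ≠ 0)
    (h : ∫ x : ℝ, f x * (((x : ℂ) - a) * (x - b))⁻¹ = 0) :
    (z - a) * ∫ x : ℝ, f x * (((x : ℂ) - z) * (x - a))⁻¹ =
      (z - b) * ∫ x : ℝ, f x * (((x : ℂ) - z) * (x - b))⁻¹ := by
  rw [← sub_eq_zero, ← integral_const_mul, ← integral_const_mul,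
    ← integral_sub ((integrable_mul_kernel hf hC hz ha).const_mul _)
      ((integrable_mul_kernel hf hC hz hb).const_mul _)]
  trans (b - a) * ∫ x : ℝ, f x * (((x : ℂ) - a) * (x - b))⁻¹
  · rw [← integral_const_mul]
    congr 1
    ext x
    have h1 := ofReal_sub_ne_zero hz x
    have h2 := ofReal_sub_ne_zero ha x
    have h3 := ofReal_sub_ne_zero hb x
    field_simp
    ring
  · rw [h, mul_zero]

/-- The Poisson integral, in the coordinates of the boundary and after rescaling. -/
lemma integral_poisson (f : ℝ → ℂ) {z : ℂ} (hz : 0 < z.im) :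
    z.im * ∫ t : ℝ, f t * (((t : ℂ) - z) * (t - conj z))⁻¹ =
      ∫ s : ℝ, f (z.re + z.im * s) * ((1 + s ^ 2)⁻¹ : ℝ) := by
  set φ : ℝ → ℂ := fun t => f t * (((t : ℂ) - z) * (t - conj z))⁻¹ with hφ
  have h1 : ∫ s : ℝ, φ (z.re + z.im * s) = |z.im⁻¹| • ∫ t : ℝ, φ t := by
    rw [Measure.integral_comp_mul_left (fun u => φ (z.re + u)), integral_add_left_eq_self]
  have h2 : ∫ t : ℝ, φ t = z.im * ∫ s : ℝ, φ (z.re + z.im * s) := by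
    rw [h1, abs_of_pos (inv_pos.2 hz), Complex.real_smul]
    push_cast
    rw [mul_inv_cancel_left₀ (by exact_mod_cast hz.ne')]
  rw [h2, ← integral_const_mul, ← integral_const_mul]
  congr 1
  ext s
  have hz' : (z.im : ℂ) ≠ 0 := by exact_mod_cast hz.ne'
  have hs : (1 + (s : ℂ) ^ 2) ≠ 0 := by
    have : (0 : ℝ) < 1 + s ^ 2 := by positivity
    exact_mod_cast this.ne'
  have h3 : (((z.re + z.im * s : ℝ) : ℂ) - z) * (((z.re + z.im * s : ℝ) : ℂ) - conj z) =
      z.im ^ 2 * (1 + (s : ℂ) ^ 2) := by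
    apply Complex.ext <;> simp [pow_two] <;> ring
  simp only [hφ]
  rw [h3]
  push_cast
  field_simp

lemma integral_poisson_one_ne_zero {z : ℂ} (hz : 0 < z.im) :
    ∫ t : ℝ, (1 : ℂ) * (((t : ℂ) - z) * (t - conj z))⁻¹ ≠ 0 := by
  intro h
  have := integral_poisson (fun _ => 1) hz
  rw [h, mul_zero] at this
  simp only [one_mul] at this
  rw [integral_complex_ofReal, integral_univ_inv_one_add_sq] at this
  exact Real.pi_ne_zero (by exact_mod_cast this.symm)

lemma HinfMinus.integral_kernel_eq_zero {a : ℝ → ℂ} (ha : a ∈ HinfMinus) {w w' : ℂ}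
    (hw : 0 < w.im) (hw' : 0 < w'.im) :
    ∫ x : ℝ, a x * (((x : ℂ) - w) * (x - w'))⁻¹ = 0 := by
  rw [mem_HinfMinus_iff] at ha
  have := HinfPlus.integral_kernel_eq_zero ha (w := -w) (w' := -w') (by simpa) (by simpa)
  rw [← integral_neg_eq_self, ← this]
  congr 1
  ext x
  congr 2
  push_cast
  ring

/-- Near z compactness gives the bound; away from z the decay of the difference quotient offsets the
growth of ζ - w. This places the quotient in the Cauchy formula in H_∞^+. -/
lemma exists_bound_dslope_mul {F : ℂ → ℂ} (hF : DifferentiableOn ℂ F upper) {C : ℝ}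
    (hC : ∀ z : ℂ, 0 < z.im → ‖F z‖ ≤ C) {z : ℂ} (hz : 0 < z.im) (w : ℂ) :
    ∃ D : ℝ, ∀ ζ : ℂ, 0 < ζ.im → ‖dslope F z ζ * (ζ - w)‖ ≤ D := by
  have hC0 : 0 ≤ C := (norm_nonneg _).trans (hC z hz)
  have hds : DifferentiableOn ℂ (dslope F z) upper :=
    (Complex.differentiableOn_dslope (isOpen_upper.mem_nhds hz)).2 hF
  have hball : Metric.closedBall z (z.im / 2) ⊆ upper := by
    intro ζ hζ
    rw [Metric.mem_closedBall, dist_eq_norm] at hζ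
    have h1 := (abs_le.1 ((Complex.abs_im_le_norm (ζ - z)).trans hζ)).1
    rw [Complex.sub_im] at h1
    change 0 < ζ.im
    linarith
  obtain ⟨D, hD⟩ := (isCompact_closedBall z (z.im / 2)).exists_bound_of_continuousOn
    (f := fun ζ => dslope F z ζ * (ζ - w)) ((hds.continuousOn.mono hball).mul (by fun_prop))
  refine ⟨max D (2 * C * (1 + ‖z - w‖ / (z.im / 2))), fun ζ hζ => ?_⟩
  by_cases hin : ζ ∈ Metric.closedBall z (z.im / 2)
  · exact (hD ζ hin).trans (le_max_left _ _)
  · refine le_trans ?_ (le_max_right _ _)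
    rw [Metric.mem_closedBall, not_le, dist_eq_norm] at hin
    have hpos : 0 < ‖ζ - z‖ := lt_trans (by positivity) hin
    have hne : ζ ≠ z := fun h => by simp [h] at hpos
    rw [dslope_of_ne _ hne, slope_def_field, norm_mul, norm_div]
    have h1 : ‖F ζ - F z‖ ≤ 2 * C := (norm_sub_le _ _).trans (by linarith [hC ζ hζ, hC z hz])
    have h2 : ‖ζ - w‖ ≤ ‖ζ - z‖ + ‖z - w‖ := by
      rw [← sub_add_sub_cancel ζ z w]; exact norm_add_le _ _
    calc ‖F ζ - F z‖ / ‖ζ - z‖ * ‖ζ - w‖ = ‖F ζ - F z‖ * (‖ζ - w‖ / ‖ζ - z‖) := by ring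
      _ ≤ 2 * C * ((‖ζ - z‖ + ‖z - w‖) / ‖ζ - z‖) := by gcongr
      _ = 2 * C * (1 + ‖z - w‖ / ‖ζ - z‖) := by rw [add_div, div_self hpos.ne']
      _ ≤ 2 * C * (1 + ‖z - w‖ / (z.im / 2)) := by gcongr

/-- A function of class `H_∞^+` and of class `H_∞^-` is constant. -/
lemma exists_ae_eq_const_of_mem_HinfPlus_of_mem_HinfMinus {f : ℝ → ℂ} (hp : f ∈ HinfPlus)
    (hm : f ∈ HinfMinus) : ∃ c : ℂ, ∀ᵐ x : ℝ, f x = c := by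
  have hmeas := HinfPlus.aestronglyMeasurable hp
  obtain ⟨B, hB⟩ := HinfPlus.ae_bounded hp
  obtain ⟨F, hF, ⟨C, hC⟩, hlim⟩ := hp
  -- Cauchy's formula: (f(x) - F z)(x - w)/(x - z) is in H_∞^+, hence orthogonal to (x - w)⁻².
  have hcauchy : ∀ z w : ℂ, 0 < z.im → w.im < 0 →
      ∫ x : ℝ, f x * (((x : ℂ) - z) * (x - w))⁻¹ =
        F z * ∫ x : ℝ, 1 * (((x : ℂ) - z) * (x - w))⁻¹ := by
    intro z w hz hw
    have hA : (fun x : ℝ => (f x - F z) / (x - z) * (x - w)) ∈ HinfPlus := by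
      refine ⟨fun ζ => dslope F z ζ * (ζ - w),
        ((Complex.differentiableOn_dslope (isOpen_upper.mem_nhds hz)).2 hF).mul (by fun_prop),
        exists_bound_dslope_mul hF hC hz w, ?_⟩
      filter_upwards [hlim] with x hx
      have hid : Tendsto (fun y : ℝ => (x : ℂ) + y * Complex.I) (𝓝[>] 0) (𝓝 x) := by
        have : Continuous fun y : ℝ => (x : ℂ) + y * Complex.I := by fun_prop
        simpa using (this.tendsto 0).mono_left nhdsWithin_le_nhds
      refine (((hx.sub_const (F z)).div (hid.sub_const z)
        (ofReal_sub_ne_zero hz.ne' x)).mul (hid.sub_const w)).congr' ?_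
      filter_upwards [Ioo_mem_nhdsGT hz] with y hy
      have hne : (x : ℂ) + y * Complex.I ≠ z := by
        intro h
        have := congrArg Complex.im h
        rw [im_add_mul_I] at this
        exact hy.2.ne this
      simp only [Pi.div_apply]
      rw [dslope_of_ne _ hne, slope_def_field]
    have h0 := HinfPlus.integral_kernel_eq_zero hA hw hw
    have i1 := integrable_mul_kernel hmeas hB hz.ne' hw.ne
    have i2 := ((integrable_kernel hz.ne' hw.ne).const_mul (F z))
    rw [← sub_eq_zero, ← h0, ← integral_const_mul]
    simp only [one_mul]
    rw [← integral_sub i1 i2]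
    congr 1
    ext x
    have h1 := ofReal_sub_ne_zero hz.ne' x
    have h2 := ofReal_sub_ne_zero hw.ne x
    field_simp
  have hone : (fun _ => 1 : ℝ → ℂ) ∈ HinfMinus := by
    have : e 0 = fun _ => 1 := by ext x; simp
    rw [← this]; exact e_mem_HinfMinus le_rfl
  have hconst : ∀ z : ℂ, 0 < z.im → F z = F Complex.I := by
    intro z hz
    have hI : 0 < Complex.I.im := by simp
    have hw : (conj z).im < 0 := by simpa using hz
    -- As a member of H_∞^-, f lets the upper pole move from z to i with conj z fixed. Comparison
    -- with the constant 1 and Cauchy's formula then give F z = F i.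
    have k1 := kernel_cocycle hmeas hB hw.ne hz.ne' hI.ne'
      (HinfMinus.integral_kernel_eq_zero hm hz hI)
    have k2 := kernel_cocycle (f := fun _ => 1) (C := 1) aestronglyMeasurable_const (by simp)
      hw.ne hz.ne' hI.ne' (HinfMinus.integral_kernel_eq_zero hone hz hI)
    simp only [mul_comm ((_ : ℂ) - conj z)] at k1 k2
    rw [hcauchy z _ hz hw, hcauchy _ _ hI hw] at k1
    have hne : (conj z - z) * ∫ x : ℝ, (1 : ℂ) * (((x : ℂ) - z) * (x - conj z))⁻¹ ≠ 0 :=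
      mul_ne_zero (sub_ne_zero_of_im (by linarith)) (integral_poisson_one_ne_zero hz)
    refine mul_right_cancel₀ hne ?_
    linear_combination k1 - F Complex.I * k2
  refine ⟨F Complex.I, hlim.mono fun x hx => ?_⟩
  refine tendsto_nhds_unique hx (tendsto_const_nhds.congr' ?_)
  filter_upwards [self_mem_nhdsWithin] with y hy
  exact (hconst _ (by simpa using hy)).symm

/-! ### Almost periodic functions with nonnegative spectrum are of class `H_∞^+` -/

lemma tendsto_avg_zero_of_approx {g : ℝ → ℂ} (hg : Continuous g)
    (h : ∀ ε : ℝ, 0 < ε → ∃ q : ℝ → ℂ, Continuous q ∧ (∀ x, ‖g x - q x‖ ≤ ε) ∧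
      Tendsto (avg q) atTop (𝓝 0)) : Tendsto (avg g) atTop (𝓝 0) := by
  rw [Metric.tendsto_nhds]
  intro ε hε
  obtain ⟨q, hq, hgq, hlim⟩ := h (ε / 2) (by positivity)
  filter_upwards [(Metric.tendsto_nhds.1 hlim) (ε / 2) (by positivity),
    eventually_gt_atTop 0] with T hT hT0
  have h1 := norm_avg_le hT0 hgq
  rw [avg_sub hg hq] at h1
  rw [dist_zero_right] at hT ⊢
  linarith [norm_sub_norm_le (avg g T) (avg q T)]

lemma integrable_comp_add_mul {f k : ℝ → ℂ} (hf : Continuous f) (hb : ∃ C : ℝ, ∀ x, ‖f x‖ ≤ C)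
    (hk : Integrable k) (s : ℝ) : Integrable fun x => f (x + s) * k x := by
  obtain ⟨C, hC⟩ := hb
  exact hk.bdd_mul (c := C) (by fun_prop : Continuous fun x => f (x + s)).aestronglyMeasurable
    (Eventually.of_forall fun x => hC _)

lemma integral_e_comp_add_mul (μ : ℝ) (k : ℝ → ℂ) (s : ℝ) :
    ∫ x, e μ (x + s) * k x = (∫ x, e μ x * k x) * e μ s := by
  rw [← integral_mul_const]
  congr 1
  ext x
  rw [e_add_arg]
  ring

lemma Trig.integral_comp_add_mul {p k : ℝ → ℂ} (hk : Integrable k) (hp : p ∈ Trig) :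
    (fun s => ∫ x, p (x + s) * k x) ∈ Trig := by
  refine Trig.induct (P := fun p => (fun s => ∫ x, p (x + s) * k x) ∈ Trig) (fun μ => ?_) ?_ ?_ ?_ hp
  · simp only [integral_e_comp_add_mul]
    exact Trig.const_mul_mem _ (Trig.e_mem μ)
  · simpa using Trig.zero_mem'
  · intro f hf g hg h1 h2
    have : (fun s => ∫ x, (f (x + s) + g (x + s)) * k x) =
        fun s => (∫ x, f (x + s) * k x) + ∫ x, g (x + s) * k x := by
      ext s
      simp only [add_mul]
      exact integral_add (integrable_comp_add_mul (Trig.continuous hf) (Trig.bounded hf) hk s)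
        (integrable_comp_add_mul (Trig.continuous hg) (Trig.bounded hg) hk s)
    rw [this]
    exact Trig.add_mem' h1 h2
  · intro c f _ h
    simp only [mul_assoc, integral_const_mul]
    exact Trig.const_mul_mem c h

lemma norm_integral_comp_add_mul_sub_le {f p k : ℝ → ℂ} (hf : Continuous f)
    (hfb : ∃ C : ℝ, ∀ x, ‖f x‖ ≤ C) (hp : Continuous p) (hpb : ∃ C : ℝ, ∀ x, ‖p x‖ ≤ C)
    (hk : Integrable k) {ε : ℝ} (h : ∀ x, ‖f x - p x‖ ≤ ε) (s : ℝ) :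
    ‖(∫ x, f (x + s) * k x) - ∫ x, p (x + s) * k x‖ ≤ (∫ x, ‖k x‖) * ε := by
  rw [← integral_sub (integrable_comp_add_mul hf hfb hk s) (integrable_comp_add_mul hp hpb hk s),
    mul_comm, ← integral_const_mul]
  refine norm_integral_le_of_norm_le (hk.norm.const_mul ε) (Eventually.of_forall fun x => ?_)
  rw [← sub_mul, norm_mul]
  gcongr
  exact h _

lemma AP.integral_comp_add_mul {f k : ℝ → ℂ} (hk : Integrable k) (hf : f ∈ AP) :
    (fun s => ∫ x, f (x + s) * k x) ∈ AP := by
  refine AP.of_approx (∫ x, ‖k x‖) fun ε hε => ?_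
  obtain ⟨p, hp, hfp⟩ := hf ε hε
  exact ⟨_, Trig.integral_comp_add_mul hk hp, norm_integral_comp_add_mul_sub_le (AP.continuous hf)
    (AP.bounded hf) (Trig.continuous hp) (Trig.bounded hp) hk hfp⟩

/-- The Bohr-Fourier coefficients of a convolution are products. -/
lemma bohrCoeff_integral_comp_add_mul {f k : ℝ → ℂ} (hk : Integrable k) (hf : f ∈ AP) (μ : ℝ) :
    bohrCoeff (fun s => ∫ x, f (x + s) * k x) μ = (∫ x, e μ x * k x) * bohrCoeff f μ := by
  set κ := ∫ x, e μ x * k x with hκ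
  set K : (ℝ → ℂ) → ℝ → ℂ := fun f s => ∫ x, f (x + s) * k x with hK
  -- K p - κ p has no component at μ: frequencies other than μ have mean zero after modulation, and
  -- at μ itself the factor vanishes.
  have htrig : ∀ p ∈ Trig, Tendsto (avg fun x => e (-μ) x * (K p x - κ * p x)) atTop (𝓝 0) := by
    intro p hp
    refine Trig.induct
      (P := fun p => Tendsto (avg fun x => e (-μ) x * (K p x - κ * p x)) atTop (𝓝 0))
      (fun ν => ?_) ?_ ?_ ?_ hp
    · have h1 : (fun x => e (-μ) x * (K (e ν) x - κ * e ν x)) =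
          fun x => ((∫ x, e ν x * k x) - κ) * e (ν - μ) x := by
        ext x
        simp only [hK, integral_e_comp_add_mul]
        rw [sub_eq_add_neg ν, e_add]
        ring
      rw [h1]
      have h2 := (tendsto_avg_e (ν - μ)).const_mul ((∫ x, e ν x * k x) - κ)
      have h3 : ((∫ x, e ν x * k x) - κ) * (if ν - μ = 0 then 1 else 0) = 0 := by
        split_ifs with h
        · rw [sub_eq_zero.1 h, ← hκ]; simp
        · simp
      rw [h3] at h2
      exact h2.congr fun T => (avg_const_mul _ _ _).symm
    · simpa [hK] using tendsto_avg_zero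
    · intro p hp q hq h1 h2
      have := h1.add h2
      rw [add_zero] at this
      refine this.congr fun T => ?_
      have c1 := Trig.continuous hp
      have c2 := Trig.continuous hq
      have c3 : Continuous (K p) := Trig.continuous (Trig.integral_comp_add_mul hk hp)
      have c4 : Continuous (K q) := Trig.continuous (Trig.integral_comp_add_mul hk hq)
      have c5 := continuous_e (-μ)
      rw [← avg_add (by fun_prop) (by fun_prop)]
      congr 1
      ext x
      have : K (fun x => p x + q x) x = K p x + K q x := by
        simp only [hK, add_mul]
        exact integral_add (integrable_comp_add_mul c1 (Trig.bounded hp) hk x)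
          (integrable_comp_add_mul c2 (Trig.bounded hq) hk x)
      rw [this]
      ring
    · intro c p _ h
      have := h.const_mul c
      rw [mul_zero] at this
      refine this.congr fun T => ?_
      rw [← avg_const_mul]
      congr 1
      ext x
      simp only [hK, mul_assoc, integral_const_mul]
      ring
  have hcf := AP.continuous hf
  have hKf : K f ∈ AP := AP.integral_comp_add_mul hk hf
  have hcK := AP.continuous hKf
  have hce := continuous_e (-μ)
  set L := ∫ x, ‖k x‖ with hL
  have hL0 : 0 ≤ L := integral_nonneg fun x => norm_nonneg _
  have hlim : Tendsto (avg fun x => e (-μ) x * (K f x - κ * f x)) atTop (𝓝 0) := by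
    refine tendsto_avg_zero_of_approx (by fun_prop) fun ε hε => ?_
    obtain ⟨p, hp, hfp⟩ := hf (ε / (L + ‖κ‖ + 1)) (by positivity)
    have hcp := Trig.continuous hp
    have hcKp : Continuous (K p) := Trig.continuous (Trig.integral_comp_add_mul hk hp)
    refine ⟨_, by fun_prop, fun x => ?_, htrig p hp⟩
    have h1 : ‖K f x - K p x‖ ≤ L * (ε / (L + ‖κ‖ + 1)) :=
      norm_integral_comp_add_mul_sub_le hcf (AP.bounded hf) hcp (Trig.bounded hp) hk hfp x
    have h2 : ‖κ * (f x - p x)‖ ≤ ‖κ‖ * (ε / (L + ‖κ‖ + 1)) := by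
      rw [norm_mul]; gcongr; exact hfp x
    rw [← mul_sub, norm_mul, norm_e, one_mul]
    calc ‖K f x - κ * f x - (K p x - κ * p x)‖ = ‖(K f x - K p x) - κ * (f x - p x)‖ := by ring_nf
      _ ≤ L * (ε / (L + ‖κ‖ + 1)) + ‖κ‖ * (ε / (L + ‖κ‖ + 1)) :=
          (norm_sub_le _ _).trans (add_le_add h1 h2)
      _ ≤ (L + ‖κ‖ + 1) * (ε / (L + ‖κ‖ + 1)) := by
          have : 0 ≤ ε / (L + ‖κ‖ + 1) := by positivity
          linarith
      _ = ε := by field_simp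
  have h1 := hlim.add ((AP.tendsto_bohrCoeff hf μ).const_mul κ)
  rw [zero_add] at h1
  refine meanValue_eq_of_tendsto (h1.congr fun T => ?_)
  rw [← avg_const_mul, ← avg_add (by fun_prop) (by fun_prop)]
  congr 1
  ext x
  simp only [hK]
  ring

/-- The correlation of f with the kernel has coefficients (∫ e_μ k) · `bohrCoeff f μ`. The first
factor vanishes for μ ≥ 0, as e_μ ∈ H_∞^+, and the second for μ < 0; uniqueness is then read at s =
0. -/
lemma AP.integral_kernel_eq_zero {f : ℝ → ℂ} (hf : f ∈ AP) (hs : spec f ⊆ Set.Ici 0) {w w' : ℂ}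
    (hw : w.im < 0) (hw' : w'.im < 0) :
    ∫ x : ℝ, f x * (((x : ℂ) - w) * (x - w'))⁻¹ = 0 := by
  have hk := integrable_kernel hw.ne hw'.ne
  have := AP.eq_zero_of_bohrCoeff (AP.integral_comp_add_mul hk hf) (fun μ => ?_) 0
  · simpa using this
  · rw [bohrCoeff_integral_comp_add_mul hk hf]
    by_cases hμ : 0 ≤ μ
    · rw [HinfPlus.integral_kernel_eq_zero (e_mem_HinfPlus hμ) hw hw', zero_mul]
    · by_cases hc : bohrCoeff f μ = 0
      · rw [hc, mul_zero]
      · exact absurd (hs hc) hμ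

/-- The auxiliary pole at -i makes the integral converge, since f is merely bounded. On the ball of
radius Im z / 2, |t - ζ| ≥ |t - z|/2 gives the dominating function. -/
lemma differentiableOn_cauchy_integral {f : ℝ → ℂ} (hf : Continuous f) {C : ℝ}
    (hC : ∀ x, ‖f x‖ ≤ C) :
    DifferentiableOn ℂ (fun z : ℂ => ∫ t : ℝ, f t * (((t : ℂ) - z) * (t - -Complex.I))⁻¹)
      upper := by
  have hI : (-Complex.I).im ≠ 0 := by simp
  have hC0 : 0 ≤ C := (norm_nonneg _).trans (hC 0)
  intro z hz
  have hz' : 0 < z.im := hz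
  have him : ∀ ζ ∈ Metric.ball z (z.im / 2), 0 < ζ.im := by
    intro ζ hζ
    rw [Metric.mem_ball, dist_eq_norm] at hζ
    have h1 := (abs_le.1 ((Complex.abs_im_le_norm (ζ - z)).trans hζ.le)).1
    rw [Complex.sub_im] at h1
    linarith
  refine (hasDerivAt_integral_of_dominated_loc_of_deriv_le
    (F := fun (ζ : ℂ) (t : ℝ) => f t * (((t : ℂ) - ζ) * (t - -Complex.I))⁻¹)
    (F' := fun (ζ : ℂ) (t : ℝ) => f t * ((((t : ℂ) - ζ) * (t - ζ))⁻¹ * (t - -Complex.I)⁻¹))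
    (bound := fun t : ℝ => C * (4 * ‖(((t : ℂ) - z) * (t - z))⁻¹‖))
    (Metric.ball_mem_nhds z (by positivity : 0 < z.im / 2)) ?_ ?_ ?_ ?_ ?_
    ?_).2.differentiableAt.differentiableWithinAt
  · filter_upwards [Metric.ball_mem_nhds z (by positivity : 0 < z.im / 2)] with ζ hζ
    exact (hf.mul (continuous_kernel (him ζ hζ).ne' hI)).aestronglyMeasurable
  · exact integrable_mul_kernel hf.aestronglyMeasurable (Eventually.of_forall hC) hz'.ne' hI
  · exact (hf.mul ((continuous_kernel hz'.ne' hz'.ne').mul (Continuous.inv₀ (by fun_prop)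
      (ofReal_sub_ne_zero hI)))).aestronglyMeasurable
  · refine Eventually.of_forall fun t ζ hζ => ?_
    have h1 : z.im ≤ ‖(t : ℂ) - z‖ := by
      have := Complex.abs_im_le_norm ((t : ℂ) - z)
      simp only [Complex.sub_im, Complex.ofReal_im, zero_sub, abs_neg, abs_of_pos hz'] at this
      exact this
    have h2 : ‖(t : ℂ) - z‖ / 2 ≤ ‖(t : ℂ) - ζ‖ := by
      rw [Metric.mem_ball, dist_eq_norm] at hζ
      have : ‖(t : ℂ) - z‖ ≤ ‖(t : ℂ) - ζ‖ + ‖ζ - z‖ := by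
        rw [← sub_add_sub_cancel (t : ℂ) ζ z]; exact norm_add_le _ _
      linarith
    have h3 : 1 ≤ ‖(t : ℂ) - -Complex.I‖ := by
      have := Complex.abs_im_le_norm ((t : ℂ) - -Complex.I)
      simpa using this
    have h4 : 0 < ‖(t : ℂ) - z‖ := by linarith
    simp only [norm_mul, norm_inv]
    calc ‖f t‖ * ((‖(t : ℂ) - ζ‖ * ‖(t : ℂ) - ζ‖)⁻¹ * ‖(t : ℂ) - -Complex.I‖⁻¹)
        ≤ C * ((‖(t : ℂ) - z‖ / 2 * (‖(t : ℂ) - z‖ / 2))⁻¹ * 1⁻¹) := by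
          gcongr
          exact hC t
      _ = C * (4 * (‖(t : ℂ) - z‖ * ‖(t : ℂ) - z‖)⁻¹) := by field_simp; ring
  · exact ((integrable_kernel hz'.ne' hz'.ne').norm.const_mul 4).const_mul C
  · refine Eventually.of_forall fun t ζ hζ => ?_
    have h1 := ofReal_sub_ne_zero (him ζ hζ).ne' t
    have h2 := ofReal_sub_ne_zero hI t
    have h3 : HasDerivAt (fun ζ : ℂ => ((t : ℂ) - ζ) * (t - -Complex.I)) (-1 * (t - -Complex.I)) ζ :=
      ((hasDerivAt_id ζ).const_sub (t : ℂ)).mul_const _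
    refine ((h3.fun_inv (mul_ne_zero h1 h2)).const_mul (f t)).congr_deriv ?_
    field_simp

/-- The Cauchy integral with auxiliary pole -i is visibly analytic. Orthogonality allows that pole
to be moved to conj z, which gives the Poisson integral and with it the bound and the boundary
values. -/
theorem APPlus.mem_HinfPlus {f : ℝ → ℂ} (hf : f ∈ APPlus) : f ∈ HinfPlus := by
  obtain ⟨hAP, hs⟩ := hf
  have hcf := AP.continuous hAP
  obtain ⟨C, hC⟩ := AP.bounded hAP
  have hC0 : 0 ≤ C := (norm_nonneg _).trans (hC 0)
  have hI : (-Complex.I).im < 0 := by simp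
  have hpi : (Real.pi : ℂ) ≠ 0 := by exact_mod_cast Real.pi_ne_zero
  set F : ℂ → ℂ := fun z => (z - -Complex.I) / (2 * Real.pi * Complex.I) *
    ∫ t : ℝ, f t * (((t : ℂ) - z) * (t - -Complex.I))⁻¹ with hF
  have hFP : ∀ z : ℂ, 0 < z.im →
      F z = (Real.pi : ℂ)⁻¹ * ∫ s : ℝ, f (z.re + z.im * s) * ((1 + s ^ 2)⁻¹ : ℝ) := by
    intro z hz
    have hw : (conj z).im < 0 := by simpa using hz
    have h1 := kernel_cocycle hcf.aestronglyMeasurable (Eventually.of_forall hC) hz.ne' hI.ne hw.ne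
      (AP.integral_kernel_eq_zero hAP hs hI hw)
    have h2 : z - conj z = 2 * z.im * Complex.I := by
      rw [Complex.sub_conj]; push_cast; ring
    rw [← integral_poisson f hz]
    simp only [hF]
    rw [div_mul_eq_mul_div, h1, h2]
    field_simp
  refine ⟨F, ?_, ⟨C, fun z hz => ?_⟩, Eventually.of_forall fun x => ?_⟩
  · exact DifferentiableOn.mul (by fun_prop) (differentiableOn_cauchy_integral hcf hC)
  · rw [hFP z hz, norm_mul, norm_inv, Complex.norm_real, Real.norm_of_nonneg Real.pi_pos.le]
    have h1 : ‖∫ s : ℝ, f (z.re + z.im * s) * ((1 + s ^ 2)⁻¹ : ℝ)‖ ≤ ∫ s : ℝ, C * (1 + s ^ 2)⁻¹ := by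
      refine norm_integral_le_of_norm_le (integrable_inv_one_add_sq.const_mul C)
        (Eventually.of_forall fun s => ?_)
      rw [norm_mul, Complex.norm_real, Real.norm_of_nonneg (by positivity)]
      gcongr
      exact hC _
    rw [integral_const_mul, integral_univ_inv_one_add_sq] at h1
    rw [inv_mul_le_iff₀ Real.pi_pos]
    linarith
  · have h1 : Tendsto (fun y : ℝ => ∫ s : ℝ, f (x + y * s) * ((1 + s ^ 2)⁻¹ : ℝ)) (𝓝[>] 0)
        (𝓝 (∫ s : ℝ, f x * ((1 + s ^ 2)⁻¹ : ℝ))) := by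
      refine tendsto_integral_filter_of_dominated_convergence (fun s => C * (1 + s ^ 2)⁻¹)
        (Eventually.of_forall fun y => ?_) (Eventually.of_forall fun y =>
          Eventually.of_forall fun s => ?_) (integrable_inv_one_add_sq.const_mul C)
        (Eventually.of_forall fun s => ?_)
      · refine Continuous.aestronglyMeasurable (Continuous.mul (by fun_prop)
          (Complex.continuous_ofReal.comp (Continuous.inv₀ (by fun_prop) fun s => ?_)))
        positivity
      · rw [norm_mul, Complex.norm_real, Real.norm_of_nonneg (by positivity)]
        gcongr
        exact hC _
      · have : Continuous fun y : ℝ => f (x + y * s) * (((1 + s ^ 2)⁻¹ : ℝ) : ℂ) := by fun_prop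
        simpa using (this.tendsto 0).mono_left nhdsWithin_le_nhds
    rw [integral_const_mul, integral_complex_ofReal, integral_univ_inv_one_add_sq] at h1
    have h2 := h1.const_mul (Real.pi : ℂ)⁻¹
    rw [mul_comm (f x), inv_mul_cancel_left₀ hpi] at h2
    refine h2.congr' ?_
    filter_upwards [self_mem_nhdsWithin] with y hy
    have hy' : 0 < y := hy
    rw [hFP _ (by simpa using hy')]
    simp

/-! ### Spectral bounds as Hardy class membership -/

lemma comp_neg_mem_APPlus {f : ℝ → ℂ} (hf : f ∈ APMinus) : (fun x => f (-x)) ∈ APPlus := by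
  refine ⟨AP.comp_neg hf.1, fun μ hμ => ?_⟩
  have := hf.2 (mem_spec_comp_neg.1 hμ)
  simpa using this

theorem APMinus.mem_HinfMinus {f : ℝ → ℂ} (hf : f ∈ APMinus) : f ∈ HinfMinus :=
  mem_HinfMinus_iff.2 (APPlus.mem_HinfPlus (comp_neg_mem_APPlus hf))

lemma e_mul_mem_APPlus {f : ℝ → ℂ} (hf : f ∈ AP) {ν : ℝ} (h : spec f ⊆ Set.Ici ν) :
    (fun x => e (-ν) x * f x) ∈ APPlus := by
  refine ⟨AP.e_mul _ hf, fun μ hμ => ?_⟩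
  have := h (mem_spec_e_mul.1 hμ)
  simp only [Set.mem_Ici] at *
  linarith

lemma e_mul_mem_APMinus {f : ℝ → ℂ} (hf : f ∈ AP) {ν : ℝ} (h : spec f ⊆ Set.Iic ν) :
    (fun x => e (-ν) x * f x) ∈ APMinus := by
  refine ⟨AP.e_mul _ hf, fun μ hμ => ?_⟩
  have := h (mem_spec_e_mul.1 hμ)
  simp only [Set.mem_Iic] at *
  linarith

/-- For the converse, the coefficient at μ < ν is the mean of e_{ν-μ} times an H_∞^+ function, which
is zero. -/
theorem spec_subset_Ici_iff {f : ℝ → ℂ} (hf : f ∈ AP) {ν : ℝ} :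
    spec f ⊆ Set.Ici ν ↔ (fun x => e (-ν) x * f x) ∈ HinfPlus := by
  refine ⟨fun h => APPlus.mem_HinfPlus (e_mul_mem_APPlus hf h), fun h μ hμ => ?_⟩
  by_contra hlt
  rw [Set.mem_Ici, not_le] at hlt
  refine hμ (meanValue_eq_of_tendsto ?_)
  have := HinfPlus.tendsto_avg_e_mul h (sub_pos.2 hlt)
  refine this.congr fun T => ?_
  congr 1
  ext x
  rw [← mul_assoc, ← e_add]
  ring_nf

theorem spec_subset_Iic_iff {f : ℝ → ℂ} (hf : f ∈ AP) {ν : ℝ} :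
    spec f ⊆ Set.Iic ν ↔ (fun x => e (-ν) x * f x) ∈ HinfMinus := by
  have h1 : spec f ⊆ Set.Iic ν ↔ spec (fun x => f (-x)) ⊆ Set.Ici (-ν) := by
    constructor
    · intro h μ hμ
      have := h (mem_spec_comp_neg.1 hμ)
      simp only [Set.mem_Iic, Set.mem_Ici] at *
      linarith
    · intro h μ hμ
      have := h (show -μ ∈ _ from mem_spec_comp_neg.2 (by rwa [neg_neg]))
      simp only [Set.mem_Iic, Set.mem_Ici] at *
      linarith
  rw [h1, spec_subset_Ici_iff (AP.comp_neg hf), mem_HinfMinus_iff]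
  simp only [e_neg_arg]

lemma HinfMinus.tendsto_avg_e_mul {a : ℝ → ℂ} (ha : a ∈ HinfMinus) {δ : ℝ} (hδ : 0 < δ) :
    Tendsto (avg fun x => e (-δ) x * a x) atTop (𝓝 0) := by
  refine (HinfPlus.tendsto_avg_e_mul (mem_HinfMinus_iff.1 ha) hδ).congr fun T => ?_
  rw [← avg_comp_neg]
  simp [e_neg_arg]

lemma AP.tendsto_avg_of_zero_notMem_spec {f : ℝ → ℂ} (hf : f ∈ AP) (h : (0 : ℝ) ∉ spec f) :
    Tendsto (avg f) atTop (𝓝 0) := by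
  have h1 := AP.tendsto_bohrCoeff hf 0
  rw [show bohrCoeff f 0 = 0 from not_not.1 h] at h1
  simpa using h1

lemma tendsto_avg_const (c : ℂ) : Tendsto (avg fun _ => c) atTop (𝓝 c) := by
  refine tendsto_const_nhds.congr' ?_
  filter_upwards [eventually_gt_atTop 0] with T hT
  have := avg_const_mul c (fun _ => 1) T
  rw [avg_one hT] at this
  simpa using this.symm

/-! ### Representations of g in terms of spectra -/

section Representation

variable {lam : ℝ} {g gm gp : ℝ → ℂ}

/-- In every representation, the two summands are the parts of `g` with negative and with positive
spectrum. -/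
theorem IsRep.ae_eq {ν β : ℝ} {ap am : ℝ → ℂ} (h : IsRep lam g ν β ap am) (hgm : gm ∈ APMinus)
    (hgp : gp ∈ APPlus) (hgm0 : (0 : ℝ) ∉ spec gm) (hgp0 : (0 : ℝ) ∉ spec gp)
    (hg : ∀ x : ℝ, g x = gm x + gp x) :
    (∀ᵐ x : ℝ, e (-ν) x * gp x = ap x) ∧ ∀ᵐ x : ℝ, e β x * gm x = am x := by
  have hp : (fun x => gp x - e ν x * ap x) ∈ HinfPlus :=
    HinfPlus.sub (APPlus.mem_HinfPlus hgp) (HinfPlus.mul (e_mem_HinfPlus h.ν_nonneg) h.ap_mem)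
  have hm : (fun x => e (-β) x * am x - gm x) ∈ HinfMinus :=
    HinfMinus.sub (HinfMinus.mul (e_mem_HinfMinus (by linarith [h.β_nonneg])) h.am_mem)
      (APMinus.mem_HinfMinus hgm)
  have heq : ∀ᵐ x : ℝ, e (-β) x * am x - gm x = gp x - e ν x * ap x := by
    filter_upwards [h.eq] with x hx
    rw [hg] at hx
    linear_combination -hx
  obtain ⟨c, hc⟩ :=
    exists_ae_eq_const_of_mem_HinfPlus_of_mem_HinfMinus hp (HinfMinus.congr_ae hm heq)
  have hcp := AP.continuous hgp.1
  have hcm := AP.continuous hgm.1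
  -- If ν > 0, both g_+ and e_ν a_+ have mean zero; if ν = 0, then β > 0 and the same comparison
  -- works for g_- and e_{-β} a_-.
  have hc0 : c = 0 := by
    rcases h.ν_nonneg.eq_or_lt with hν | hν
    · have hβ : 0 < β := by have := h.sum_pos; linarith
      have h1 := (AP.tendsto_avg_of_zero_notMem_spec hgm.1 hgm0).add (tendsto_avg_const c)
      have h2 := HinfMinus.tendsto_avg_e_mul h.am_mem hβ
      rw [zero_add] at h1
      refine tendsto_nhds_unique (h1.congr fun T => ?_) h2
      rw [← avg_add hcm continuous_const]
      refine avg_congr_ae ?_ T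
      filter_upwards [hc, heq] with x hx hx'
      linear_combination -hx - hx'
    · have h1 := (AP.tendsto_avg_of_zero_notMem_spec hgp.1 hgp0).sub (tendsto_avg_const c)
      have h2 := HinfPlus.tendsto_avg_e_mul h.ap_mem hν
      rw [zero_sub] at h1
      refine neg_eq_zero.1 (tendsto_nhds_unique (h1.congr fun T => ?_) h2)
      rw [← avg_sub hcp continuous_const]
      refine avg_congr_ae ?_ T
      filter_upwards [hc] with x hx
      linear_combination hx
  subst hc0
  have hinv : ∀ a x : ℝ, e (-a) x * e a x = 1 := fun a x => by rw [← e_add]; simp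
  constructor
  · filter_upwards [hc] with x hx
    linear_combination e (-ν) x * hx + ap x * hinv ν x
  · filter_upwards [hc, heq] with x hx hx'
    linear_combination -(e β x) * (hx + hx') + am x * hinv β x

theorem IsRep.spec_subset {ν β : ℝ} {ap am : ℝ → ℂ} (h : IsRep lam g ν β ap am)
    (hgm : gm ∈ APMinus) (hgp : gp ∈ APPlus) (hgm0 : (0 : ℝ) ∉ spec gm)
    (hgp0 : (0 : ℝ) ∉ spec gp) (hg : ∀ x : ℝ, g x = gm x + gp x) :
    spec gp ⊆ Set.Ici ν ∧ spec gm ⊆ Set.Iic (-β) := by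
  obtain ⟨h1, h2⟩ := h.ae_eq hgm hgp hgm0 hgp0 hg
  rw [spec_subset_Ici_iff hgp.1, spec_subset_Iic_iff hgm.1, neg_neg]
  exact ⟨HinfPlus.congr_ae h.ap_mem (h1.mono fun _ hx => hx.symm),
    HinfMinus.congr_ae h.am_mem (h2.mono fun _ hx => hx.symm)⟩

/-- Since ν + ν/(N-1) = νN/(N-1), the condition on a_+ places e_{-νN/(N-1)} g_+ in H_∞^-; likewise
for β and g_-. -/
theorem BandLimited.spec_subset {N : ℕ} (hN : 1 < N) {ν β : ℝ} {ap am : ℝ → ℂ}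
    (hb : BandLimited N ν β ap am) (h : IsRep lam g ν β ap am)
    (hgm : gm ∈ APMinus) (hgp : gp ∈ APPlus) (hgm0 : (0 : ℝ) ∉ spec gm)
    (hgp0 : (0 : ℝ) ∉ spec gp) (hg : ∀ x : ℝ, g x = gm x + gp x) :
    spec gp ⊆ Set.Iic (ν * N / (N - 1)) ∧ spec gm ⊆ Set.Ici (-(β * N / (N - 1))) := by
  obtain ⟨h1, h2⟩ := h.ae_eq hgm hgp hgm0 hgp0 hg
  have hN' : (N : ℝ) - 1 ≠ 0 := by
    have : (1 : ℝ) < N := by exact_mod_cast hN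
    linarith
  rw [spec_subset_Ici_iff hgm.1, spec_subset_Iic_iff hgp.1, neg_neg]
  constructor
  · refine HinfMinus.congr_ae hb.2 ?_
    filter_upwards [h1] with x hx
    rw [← hx, ← mul_assoc, ← e_add]
    congr 2
    field_simp
    ring
  · refine HinfPlus.congr_ae hb.1 ?_
    filter_upwards [h2] with x hx
    rw [← hx, ← mul_assoc, ← e_add]
    congr 2
    field_simp
    ring

theorem isRep_of_spec_subset (hgm : gm ∈ APMinus) (hgp : gp ∈ APPlus)
    (hg : ∀ x : ℝ, g x = gm x + gp x) {ν β : ℝ} (hν : 0 ≤ ν) (hβ : 0 ≤ β) (hpos : 0 < ν + β)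
    (hle : ν + β ≤ lam) (hsp : spec gp ⊆ Set.Ici ν) (hsm : spec gm ⊆ Set.Iic (-β)) :
    IsRep lam g ν β (fun x => gp x * e (-ν) x) (fun x => gm x * e β x) where
  ap_mem := by simpa only [mul_comm] using (spec_subset_Ici_iff hgp.1).1 hsp
  am_mem := by simpa only [mul_comm, neg_neg] using (spec_subset_Iic_iff hgm.1).1 hsm
  ν_nonneg := hν
  ν_le := by linarith
  β_nonneg := hβ
  β_le := by linarith
  sum_pos := hpos
  eq := Eventually.of_forall fun x => by
    rw [hg, mul_assoc, mul_assoc, ← e_add, ← e_add]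
    simp

theorem bandLimited_of_spec_subset (hgm : gm ∈ APMinus) (hgp : gp ∈ APPlus) {N : ℕ} (hN : 1 < N)
    {ν β : ℝ} (hsp : spec gp ⊆ Set.Iic (ν * N / (N - 1)))
    (hsm : spec gm ⊆ Set.Ici (-(β * N / (N - 1)))) :
    BandLimited N ν β (fun x => gp x * e (-ν) x) (fun x => gm x * e β x) := by
  have hN' : (N : ℝ) - 1 ≠ 0 := by
    have : (1 : ℝ) < N := by exact_mod_cast hN
    linarith
  rw [spec_subset_Ici_iff hgm.1, neg_neg] at hsm
  rw [spec_subset_Iic_iff hgp.1] at hsp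
  constructor
  · convert hsm using 2 with x
    beta_reduce
    rw [mul_comm (gm x), ← mul_assoc, ← e_add]
    congr 2
    field_simp
    ring
  · convert hsp using 2 with x
    beta_reduce
    rw [mul_comm (gp x), ← mul_assoc, ← e_add]
    congr 2
    field_simp
    ring

end Representation

/-! ### Spectral endpoints in the extended reals -/

lemma coe_le_infSpec_iff {f : ℝ → ℂ} {a : ℝ} : (a : EReal) ≤ infSpec f ↔ spec f ⊆ Set.Ici a := by
  simp [infSpec, le_sInf_iff, Set.subset_def]

lemma supSpec_le_coe_iff {f : ℝ → ℂ} {a : ℝ} : supSpec f ≤ (a : EReal) ↔ spec f ⊆ Set.Iic a := by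
  simp [supSpec, sSup_le_iff, Set.subset_def]

lemma coe_le_neg_supSpec_iff {f : ℝ → ℂ} {a : ℝ} :
    (a : EReal) ≤ -supSpec f ↔ spec f ⊆ Set.Iic (-a) := by
  rw [EReal.le_neg, ← EReal.coe_neg, supSpec_le_coe_iff]

lemma neg_infSpec_le_coe_iff {f : ℝ → ℂ} {a : ℝ} :
    -infSpec f ≤ (a : EReal) ↔ spec f ⊆ Set.Ici (-a) := by
  rw [EReal.neg_le, ← EReal.coe_neg, coe_le_infSpec_iff]

lemma infSpec_le_supSpec {f : ℝ → ℂ} (h : (spec f).Nonempty) : infSpec f ≤ supSpec f :=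
  sInf_le_sSup (h.image _)

/-- The order can fail only for an empty spectrum, whose infimum is ⊤. -/
lemma infSpec_le_supSpec_of_ne_top {f : ℝ → ℂ} (h : infSpec f ≠ ⊤) : infSpec f ≤ supSpec f := by
  refine infSpec_le_supSpec (Set.nonempty_iff_ne_empty.2 fun h' => h ?_)
  simp [infSpec, h']

lemma infSpec_le_supSpec_of_ne_bot {f : ℝ → ℂ} (h : supSpec f ≠ ⊥) : infSpec f ≤ supSpec f := by
  refine infSpec_le_supSpec (Set.nonempty_iff_ne_empty.2 fun h' => h ?_)
  simp [supSpec, h']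

/-- As much of t as possible is taken from a and the rest from b; this realises prescribed sums ν +
β. -/
lemma exists_add_eq_of_le_add {a b : EReal} (ha : 0 ≤ a) (hb : 0 ≤ b) {t : ℝ} (ht : 0 ≤ t)
    (h : (t : EReal) ≤ a + b) :
    ∃ u v : ℝ, 0 ≤ u ∧ 0 ≤ v ∧ u + v = t ∧ (u : EReal) ≤ a ∧ (v : EReal) ≤ b := by
  by_cases hat : (t : EReal) ≤ a
  · exact ⟨t, 0, ht, le_rfl, add_zero t, hat, by simpa using hb⟩
  · rw [not_le] at hat
    lift a to ℝ using ⟨(hat.trans (EReal.coe_lt_top t)).ne, (lt_of_lt_of_le EReal.bot_lt_zero ha).ne'⟩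
    have ha' : 0 ≤ a := by exact_mod_cast ha
    have hat' : a < t := by exact_mod_cast hat
    refine ⟨a, t - a, ha', by linarith, by ring, le_rfl, ?_⟩
    induction b using EReal.rec with
    | bot => simp at hb
    | top => exact le_top
    | coe b =>
      have : t ≤ a + b := by exact_mod_cast h
      exact_mod_cast (by linarith : t - a ≤ b)

/-- The endpoint conditions force the endpoints to be real. -/
lemma EndpointConditions.exists_real {lam : ℝ} {N : ℕ} (hN : 1 < N)
    {η1m η2m η1p η2p : EReal} (h : EndpointConditions lam N η1m η2m η1p η2p)
    (hm0 : 0 ≤ η1m) (hp0 : 0 ≤ η1p) (hm : η1m ≠ ⊤ → η1m ≤ η2m) (hp : η1p ≠ ⊤ → η1p ≤ η2p) :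
    ∃ m1 m2 p1 p2 : ℝ, η1m = m1 ∧ η2m = m2 ∧ η1p = p1 ∧ η2p = p2 ∧ 0 ≤ m1 ∧ 0 ≤ p1 ∧ m1 ≤ m2 ∧
      p1 ≤ p2 ∧ 0 < m1 + p1 ∧ N = ⌈lam / (m1 + p1)⌉₊ ∧ ((N : ℝ) - 1) / N * m2 ≤ m1 ∧
      ((N : ℝ) - 1) / N * p2 ≤ p1 ∧ p2 + m2 ≤ lam / ((N : ℝ) - 1) := by
  obtain ⟨⟨s, hs, hsum, hNs⟩, h1, h2, h3⟩ := h
  have hN' : (1 : ℝ) < N := by exact_mod_cast hN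
  have hκ : (0 : ℝ) < ((N : ℝ) - 1) / N := div_pos (by linarith) (by linarith)
  have hmt : η1m ≠ ⊤ := by
    rintro rfl
    rw [EReal.top_add_of_ne_bot (lt_of_lt_of_le EReal.bot_lt_zero hp0).ne'] at hsum
    exact EReal.coe_ne_top s hsum.symm
  have hpt : η1p ≠ ⊤ := by
    rintro rfl
    rw [EReal.add_top_of_ne_bot (lt_of_lt_of_le EReal.bot_lt_zero hm0).ne'] at hsum
    exact EReal.coe_ne_top s hsum.symm
  have hm' := hm hmt
  have hp' := hp hpt
  -- Here N > 1 matters: the factor (N-1)/N is positive, so an infinite outer endpoint would make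
  -- the inner one infinite.
  have hm2t : η2m ≠ ⊤ := by
    rintro rfl
    rw [EReal.coe_mul_top_of_pos hκ] at h1
    exact hmt (top_le_iff.1 h1)
  have hp2t : η2p ≠ ⊤ := by
    rintro rfl
    rw [EReal.coe_mul_top_of_pos hκ] at h2
    exact hpt (top_le_iff.1 h2)
  have hb := EReal.bot_lt_zero
  lift η2m to ℝ using ⟨hm2t, (hb.trans_le (hm0.trans hm')).ne'⟩
  lift η2p to ℝ using ⟨hp2t, (hb.trans_le (hp0.trans hp')).ne'⟩
  lift η1m to ℝ using ⟨hmt, (hb.trans_le hm0).ne'⟩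
  lift η1p to ℝ using ⟨hpt, (hb.trans_le hp0).ne'⟩
  have hsum' : η1m + η1p = s := by exact_mod_cast hsum
  subst hsum'
  exact ⟨η1m, η2m, η1p, η2p, rfl, rfl, rfl, rfl, by exact_mod_cast hm0, by exact_mod_cast hp0,
    by exact_mod_cast hm', by exact_mod_cast hp', hs, hNs, by exact_mod_cast h1,
    by exact_mod_cast h2, by exact_mod_cast h3⟩

lemma lowerBound_coe (lam : ℝ) (N : ℕ) (m1 p2 : ℝ) :
    lowerBound lam N m1 p2 = ((max (lam / N - m1) (((N : ℝ) - 1) / N * p2) : ℝ) : EReal) := by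
  rw [lowerBound, ← EReal.coe_sub, ← EReal.coe_mul]
  exact (EReal.coe_strictMono.monotone.map_max).symm

lemma upperBound_coe (lam : ℝ) (N : ℕ) (m2 p1 : ℝ) :
    upperBound lam N m2 p1 = ((min p1 ((lam - ((N : ℝ) - 1) * m2) / N) : ℝ) : EReal) := by
  rw [upperBound, ← EReal.coe_mul, ← EReal.coe_sub, ← EReal.coe_div]
  exact (EReal.coe_strictMono.monotone.map_min).symm

end APGap

end
-- The endpoint criterion
theorem mainTheorem12 (lam : ℝ) (hlam : 0 < lam) (g gm gp : ℝ → ℂ)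
    (hgm : gm ∈ APGap.APMinus) (hgp : gp ∈ APGap.APPlus)
    (hgm0 : (0 : ℝ) ∉ APGap.spec gm) (hgp0 : (0 : ℝ) ∉ APGap.spec gp)
    (hg : ∀ x : ℝ, g x = gm x + gp x)
    (η1m η2m η1p η2p : EReal)
    (hη1m : η1m = -APGap.supSpec gm) (hη2m : η2m = -APGap.infSpec gm)
    (hη1p : η1p = APGap.infSpec gp) (hη2p : η2p = APGap.supSpec gp) :
    (g ∈ APGap.S lam 1 ↔ (lam : EReal) ≤ η1p + η1m) ∧
    (∀ N : ℕ, 1 < N →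
      (g ∈ APGap.S lam N ↔ APGap.EndpointConditions lam N η1m η2m η1p η2p)) ∧
    (∀ N : ℕ, 1 < N → APGap.EndpointConditions lam N η1m η2m η1p η2p →
      APGap.lowerBound lam N η1m η2p ≤ APGap.upperBound lam N η2m η1p ∧
      ∀ ν β : ℝ, ∀ ap am : ℝ → ℂ,
        APGap.lowerBound lam N η1m η2p ≤ (ν : EReal) →
        (ν : EReal) ≤ APGap.upperBound lam N η2m η1p →
        (∀ x : ℝ, ap x = gp x * APGap.e (-ν) x) →
        β = lam / N - ν →
        (∀ x : ℝ, am x = gm x * APGap.e β x) →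
        ap ∈ APGap.APPlus ∧ am ∈ APGap.APMinus ∧
        APGap.IsRep lam g ν β ap am ∧ lam / (ν + β) = N ∧
        APGap.BandLimited N ν β ap am) := by
  have hp0 : 0 ≤ η1p := by
    rw [hη1p]; exact_mod_cast APGap.coe_le_infSpec_iff.2 hgp.2
  have hm0 : 0 ≤ η1m := by
    rw [hη1m]
    have := APGap.coe_le_neg_supSpec_iff (a := 0).2 (by simpa using hgm.2)
    exact_mod_cast this
  have hple : η1p ≠ ⊤ → η1p ≤ η2p := by
    rw [hη1p, hη2p]; exact APGap.infSpec_le_supSpec_of_ne_top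
  have hmle : η1m ≠ ⊤ → η1m ≤ η2m := by
    rw [hη1m, hη2m]
    intro h
    exact EReal.neg_le_neg_iff.2 (APGap.infSpec_le_supSpec_of_ne_bot fun h' => h (by rw [h']; rfl))
  have hspec : ∀ {ν β : ℝ} {ap am : ℝ → ℂ}, APGap.IsRep lam g ν β ap am →
      (ν : EReal) ≤ η1p ∧ (β : EReal) ≤ η1m := by
    intro ν β ap am h
    obtain ⟨h1, h2⟩ := h.spec_subset hgm hgp hgm0 hgp0 hg
    rw [hη1p, hη1m, APGap.coe_le_infSpec_iff, APGap.coe_le_neg_supSpec_iff]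
    exact ⟨h1, h2⟩
  have hrep : ∀ {ν β : ℝ}, 0 ≤ ν → 0 ≤ β → 0 < ν + β → ν + β ≤ lam → (ν : EReal) ≤ η1p →
      (β : EReal) ≤ η1m →
      APGap.IsRep lam g ν β (fun x => gp x * APGap.e (-ν) x) (fun x => gm x * APGap.e β x) := by
    intro ν β hν hβ hpos hle h1 h2
    rw [hη1p, APGap.coe_le_infSpec_iff] at h1
    rw [hη1m, APGap.coe_le_neg_supSpec_iff] at h2
    exact APGap.isRep_of_spec_subset hgm hgp hg hν hβ hpos hle h1 h2
  have hrepsum : ∀ {t : ℝ}, 0 < t → t ≤ lam → (t : EReal) ≤ η1p + η1m →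
      ∃ (ν β : ℝ) (ap am : ℝ → ℂ), APGap.IsRep lam g ν β ap am ∧ ν + β = t := by
    intro t ht htl h
    obtain ⟨ν, β, hν, hβ, hsum, h1, h2⟩ := APGap.exists_add_eq_of_le_add hp0 hm0 ht.le h
    exact ⟨ν, β, _, _, hrep hν hβ (by linarith) (by linarith) h1 h2, hsum⟩
  have hthird : ∀ N : ℕ, 1 < N → APGap.EndpointConditions lam N η1m η2m η1p η2p →
      APGap.lowerBound lam N η1m η2p ≤ APGap.upperBound lam N η2m η1p ∧
      ∀ ν β : ℝ, ∀ ap am : ℝ → ℂ,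
        APGap.lowerBound lam N η1m η2p ≤ (ν : EReal) →
        (ν : EReal) ≤ APGap.upperBound lam N η2m η1p →
        (∀ x : ℝ, ap x = gp x * APGap.e (-ν) x) →
        β = lam / N - ν →
        (∀ x : ℝ, am x = gm x * APGap.e β x) →
        ap ∈ APGap.APPlus ∧ am ∈ APGap.APMinus ∧
        APGap.IsRep lam g ν β ap am ∧ lam / (ν + β) = N ∧
        APGap.BandLimited N ν β ap am := by
    intro N hN hE
    obtain ⟨m1, m2, p1, p2, e1, e2, e3, e4, hm1, hp1, hm12, hp12, hs, hNs, c1, c2, c3⟩ :=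
      hE.exists_real hN hm0 hp0 hmle hple
    have hN' : (1 : ℝ) < N := by exact_mod_cast hN
    have hN0 : (0 : ℝ) < N := by linarith
    have hN1 : (0 : ℝ) < (N : ℝ) - 1 := by linarith
    have hceil : lam / N ≤ m1 + p1 := by
      have : lam / (m1 + p1) ≤ N := by
        conv_rhs => rw [hNs]
        exact Nat.le_ceil _
      rw [div_le_iff₀ hs] at this
      rw [div_le_iff₀ hN0]
      linarith
    rw [e1, e2, e3, e4, APGap.lowerBound_coe, APGap.upperBound_coe]
    constructor
    -- The four comparisons come, in order, from the ceiling condition, the bound on η_{1-}, the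
    -- bound on η_{1+}, and the bound on η_{2+} + η_{2-}.
    · rw [EReal.coe_le_coe_iff, max_le_iff, le_min_iff, le_min_iff]
      rw [div_mul_eq_mul_div, div_le_iff₀ hN0] at c1
      rw [le_div_iff₀ hN1] at c3
      refine ⟨⟨by linarith, ?_⟩, c2, ?_⟩
      · rw [le_div_iff₀ hN0, sub_mul, div_mul_cancel₀ _ hN0.ne']
        linarith
      · rw [div_mul_eq_mul_div, div_le_div_iff_of_pos_right hN0]
        linarith
    · intro ν β ap am hl hu hap hβ ham
      rw [EReal.coe_le_coe_iff, max_le_iff] at hl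
      rw [EReal.coe_le_coe_iff, le_min_iff] at hu
      obtain ⟨l1, l2⟩ := hl
      obtain ⟨u1, u2⟩ := hu
      have hν0 : 0 ≤ ν := le_trans (by have := hp1.trans hp12; positivity) l2
      -- The second upper bound on ν is a lower bound on β = λ/N - ν.
      have hβm2 : ((N : ℝ) - 1) / N * m2 ≤ β := by
        rw [hβ, le_sub_iff_add_le, div_mul_eq_mul_div]
        rw [sub_div] at u2
        linarith
      have hβ0 : 0 ≤ β := le_trans (by have := hm1.trans hm12; positivity) hβm2
      have hsum : ν + β = lam / N := by rw [hβ]; ring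
      have hβ1 : β ≤ m1 := by linarith
      obtain rfl : ap = fun x => gp x * APGap.e (-ν) x := funext hap
      obtain rfl : am = fun x => gm x * APGap.e β x := funext ham
      have hsp : APGap.spec gp ⊆ Set.Ici ν := by
        rw [← APGap.coe_le_infSpec_iff, ← hη1p, e3]; exact_mod_cast u1
      have hsm : APGap.spec gm ⊆ Set.Iic (-β) := by
        rw [← APGap.coe_le_neg_supSpec_iff, ← hη1m, e1]; exact_mod_cast hβ1
      have hsp2 : APGap.spec gp ⊆ Set.Iic (ν * N / (N - 1)) := by
        rw [← APGap.supSpec_le_coe_iff, ← hη2p, e4, EReal.coe_le_coe_iff, le_div_iff₀ hN1]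
        rw [div_mul_eq_mul_div, div_le_iff₀ hN0] at l2
        linarith
      have hsm2 : APGap.spec gm ⊆ Set.Ici (-(β * N / (N - 1))) := by
        rw [← APGap.neg_infSpec_le_coe_iff, ← hη2m, e2, EReal.coe_le_coe_iff, le_div_iff₀ hN1]
        rw [div_mul_eq_mul_div, div_le_iff₀ hN0] at hβm2
        linarith
      have hpos : 0 < ν + β := by rw [hsum]; positivity
      have hle : ν + β ≤ lam := by
        rw [hsum]; exact div_le_self hlam.le hN'.le
      refine ⟨?_, ?_, APGap.isRep_of_spec_subset hgm hgp hg hν0 hβ0 hpos hle hsp hsm, ?_,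
        APGap.bandLimited_of_spec_subset hgm hgp hN hsp2 hsm2⟩
      · simpa only [mul_comm] using APGap.e_mul_mem_APPlus hgp.1 hsp
      · simpa only [mul_comm, neg_neg] using APGap.e_mul_mem_APMinus hgm.1 hsm
      · rw [hsum]; field_simp
  have hfirst : g ∈ APGap.S lam 1 ↔ (lam : EReal) ≤ η1p + η1m := by
    constructor
    · rintro ⟨⟨ν, β, ap, am, h, hN, -⟩, -⟩
      obtain ⟨h1, h2⟩ := hspec h
      have hsum : lam = ν + β := by
        have := h.sum_pos
        rw [div_eq_iff this.ne'] at hN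
        simpa using hN
      rw [hsum, EReal.coe_add]
      exact add_le_add h1 h2
    · intro h
      obtain ⟨ν, β, ap, am, hr, hsum⟩ := hrepsum hlam le_rfl h
      refine ⟨⟨ν, β, ap, am, hr, ?_, fun h => absurd h (lt_irrefl 1)⟩, fun ν' β' _ _ h' => ?_⟩
      · rw [hsum, div_self hlam.ne']; simp
      · exact Nat.one_le_ceil_iff.2 (div_pos hlam h'.sum_pos)
  refine ⟨hfirst, fun N hN => ⟨?_, fun hE => ?_⟩, hthird⟩
  · rintro ⟨⟨ν, β, ap, am, h, hNeq, hb⟩, hmin⟩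
    have hN' : (1 : ℝ) < N := by exact_mod_cast hN
    have hN0 : (0 : ℝ) < N := by linarith
    have hN1 : (0 : ℝ) < (N : ℝ) - 1 := by linarith
    obtain ⟨h1, h2⟩ := hspec h
    obtain ⟨b1, b2⟩ := (hb hN).spec_subset hN h hgm hgp hgm0 hgp0 hg
    rw [← APGap.supSpec_le_coe_iff, ← hη2p] at b1
    rw [← APGap.neg_infSpec_le_coe_iff, ← hη2m] at b2
    have hsum : ν + β = lam / N := by
      rw [div_eq_iff h.sum_pos.ne'] at hNeq
      rw [hNeq]; field_simp
    -- Otherwise some representation has ν + β = λ, whose ceiling 1 contradicts the minimality of N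
    -- > 1.
    have hlt : η1p + η1m < lam := by
      by_contra hge
      obtain ⟨ν', β', ap', am', hr, hsum'⟩ := hrepsum hlam le_rfl (not_lt.1 hge)
      have := hmin ν' β' ap' am' hr
      rw [hsum', div_self hlam.ne', Nat.ceil_one] at this
      omega
    have hge : ((ν + β : ℝ) : EReal) ≤ η1p + η1m := by
      rw [EReal.coe_add]; exact add_le_add h1 h2
    have hκ : (0 : EReal) ≤ (((((N : ℝ) - 1) / N : ℝ)) : EReal) := by
      exact_mod_cast (div_pos hN1 hN0).le
    refine ⟨?_, ?_, ?_, ?_⟩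
    · obtain ⟨s, hs⟩ : ∃ s : ℝ, η1p + η1m = s :=
        ⟨(η1p + η1m).toReal, (EReal.coe_toReal (hlt.trans (EReal.coe_lt_top _)).ne
          ((EReal.bot_lt_coe _).trans_le hge).ne').symm⟩
      rw [hs, EReal.coe_le_coe_iff] at hge
      rw [hs, EReal.coe_lt_coe_iff] at hlt
      have hs0 : 0 < s := h.sum_pos.trans_le hge
      -- Minimality applied to a representation with ν' + β' = s gives N ≤ ⌈λ/s⌉; the given one has
      -- λ/N = ν + β ≤ s, which gives the reverse.
      refine ⟨s, hs0, by rw [add_comm, hs], le_antisymm ?_ ?_⟩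
      · obtain ⟨ν', β', ap', am', hr, hsum'⟩ := hrepsum hs0 hlt.le hs.ge
        rw [← hsum']
        exact hmin ν' β' ap' am' hr
      · rw [Nat.ceil_le, div_le_iff₀ hs0, ← div_le_iff₀' hN0, ← hsum]
        exact hge
    · refine (mul_le_mul_of_nonneg_left b2 hκ).trans (le_trans (le_of_eq ?_) h2)
      rw [← EReal.coe_mul]
      congr 1
      field_simp
    · refine (mul_le_mul_of_nonneg_left b1 hκ).trans (le_trans (le_of_eq ?_) h1)
      rw [← EReal.coe_mul]
      congr 1
      field_simp
    · refine (add_le_add b1 b2).trans (le_of_eq ?_)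
      rw [← EReal.coe_add]
      congr 1
      rw [← add_div, ← add_mul, hsum, div_mul_cancel₀ _ hN0.ne']
  · obtain ⟨hle, hall⟩ := hthird N hN hE
    obtain ⟨m1, m2, p1, p2, e1, e2, e3, e4, -, -, -, -, hs, hNs, -, -, -⟩ :=
      hE.exists_real hN hm0 hp0 hmle hple
    -- Any ν in [M, m] would do; the left end M is chosen.
    obtain ⟨ν, hν⟩ : ∃ ν : ℝ, APGap.lowerBound lam N η1m η2p = ν := by
      rw [e1, e4, APGap.lowerBound_coe]; exact ⟨_, rfl⟩
    rw [hν] at hle hall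
    obtain ⟨-, -, hr, hNeq, hb⟩ := hall ν _ _ _ le_rfl hle (fun _ => rfl) rfl (fun _ => rfl)
    refine ⟨⟨ν, _, _, _, hr, hNeq, fun _ => hb⟩, fun ν' β' ap' am' h' => ?_⟩
    obtain ⟨h1, h2⟩ := hspec h'
    rw [e3, EReal.coe_le_coe_iff] at h1
    rw [e1, EReal.coe_le_coe_iff] at h2
    rw [hNs]
    -- Every representation has ν' + β' ≤ η_{1+} + η_{1-}, so none has a smaller ceiling.
    refine Nat.ceil_mono (div_le_div_of_nonneg_left hlam.le h'.sum_pos ?_)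
    linarith
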